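/- Let $\mathfrak g$ be a finite-dimensional complex simple Lie algebra not isomorphic to $\mathfrak{sl}(2,\mathbb C)$ (i.e. of rank at least $2$), $\mathfrak h$ a Cartan subalgebra, $\Delta^+$ a positive root system with set of simple roots $\Pi=\{\alpha_1,\dots,\alpha_r\}$, $\theta$ the maximal root, $h_\alpha$ the coroot of $\alpha$, $\rho=\frac12\sum_{\alpha\in\Delta^+}\alpha$, and $\Delta^+_\theta=\Delta^+\setminus\{\theta\}$. Let $\mathfrak n$ and $\bar{\mathfrak n}$ be the sums of the positive, respectively negative, root spaces. Fix root vectors $e_\alpha\in\mathfrak g_\alpha$, $f_\alpha\in\mathfrak g_{-\alpha}$ ($\alpha\in\Delta^+$), forming bases of $\mathfrak n$ and $\bar{\mathfrak n}$, such that $(e_\theta,h_\theta,f_\theta)$ is an $\mathfrak{sl}_2$-triple; let $\mathfrak s_\theta$ be its span and $\mathrm{Cas}_\theta=e_\theta f_\theta+f_\theta e_\theta+\frac12h_\theta^2\in U(\mathfrak s_\theta)$. Let $\mathcal A$ be the Weyl algebra generated by $x_\alpha,\partial_{x_\alpha}$ ($\alpha\in\Delta^+$). For $w\in\mathbb C[x]\otimes\bar{\mathfrak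 n}$, $\lambda\in\mathfrak h^*$ and $a\in\mathfrak g$ put $$D_{w,\lambda}(a)=-\sum_{\alpha\in\Delta^+}\Big[\frac{\mathrm{ad}(w)\,e^{\mathrm{ad}(w)}}{e^{\mathrm{ad}(w)}-\mathrm{id}}\,\big(e^{-\mathrm{ad}(w)}a\big)_{\bar{\mathfrak n}}\Big]_\alpha\partial_{x_\alpha}+(\lambda+\rho)\big((e^{-\mathrm{ad}(w)}a)_{\mathfrak h}\big)\in\mathcal A ,$$ where $[\,\cdot\,]_\alpha$ is the coordinate along $f_\alpha$ and $(\cdot)_{\bar{\mathfrak n}}$, $(\cdot)_{\mathfrak h}$ are the components in $\mathfrak g=\bar{\mathfrak n}\oplus\mathfrak h\oplus\mathfrak n$. Let $\pi_\lambda=D_{u,\lambda}$ with $u=\sum_{\alpha\in\Delta^+}x_\alpha f_\alpha$ and $\sigma_\lambda=D_{v,\lambda}$ with $v=\sum_{\alpha\in\Delta^+_\theta}x_\alpha f_\alpha$. Let $W=\mathcal A/\mathcal I$, where $\mathcal I$ is the left ideal generated by the $x_\alpha$ ($\alpha\in\Delta^+_\theta$) and $\partial_{x_\theta}$; elements of $\mathcal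 A$ act on $W$ by left multiplication. For $c\in\mathbb N_0^{\Delta^+}$ let $w_c\in W$ be the class of $\prod_{\alpha\in\Delta^+_\theta}\partial_{x_\alpha}^{c_\alpha}\,x_\theta^{c_\theta}$; it is denoted $w_{\lambda,c}$ when $\mathfrak g$ acts on $W$ through $\pi_{\lambda+\rho}$. Write $\alpha=\sum_i m_{\alpha,i}\alpha_i$ for $\alpha\in\Delta^+$. For $\alpha\in\Delta^+\setminus\Pi$ let $t_\alpha\in\mathbb Z^{\Delta^+}$ have value $1$ at $\alpha$, value $m_{\theta,i}$ at $\alpha_i$ if $\alpha=\theta$ and $-m_{\alpha,i}$ at $\alpha_i$ if $\alpha\ne\theta$, and value $0$ elsewhere. Let $\Lambda^\theta_+$ be the set of all sums $\sum_{\alpha\in\Delta^+_\theta\setminus\Pi}n_\alpha t_\alpha$ with $n_\alpha\in\mathbb N_0$. Regard $\mathbb Z^\Pi\subset\mathbb Z^{\Delta^+}$ by extension by zero, and for $a\in\mathbb Z^{\Delta^+}$ let $\mu_{\lambda,a}=-\sum_{\alpha\in\Delta^+_\theta}a_\alpha\alpha+a_\theta\theta+\lambda+\theta$. Then for every $\lambda\in\mathfrak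 h^*$: (i) $\pi_\lambda|_{\mathfrak s_\theta}$ extends to an algebra homomorphism $U(\mathfrak s_\theta)\to\mathcal A$, also denoted $\pi_\lambda$, and $\pi_\lambda(\mathrm{Cas}_\theta)=\pi_\lambda(\mathrm{Cas}_\theta)_s+\pi_\lambda(\mathrm{Cas}_\theta)_n$, where $\pi_\lambda(\mathrm{Cas}_\theta)_s=\frac12\sigma_\lambda(h_\theta)(\sigma_\lambda(h_\theta)-2)$ acts on $W$ as a semisimple operator and $\pi_\lambda(\mathrm{Cas}_\theta)_n=2\sigma_\lambda(e_\theta)\sigma_\lambda(f_\theta)$ acts on $W$ as a locally nilpotent operator. (ii) For every $a\in\mathbb Z^\Pi$ there is a smallest $n_a\in\mathbb N_0$ with $a+n_at_\theta\in\mathbb N_0^{\Delta^+}$, and for all $n_\theta\in\mathbb N_0$ and $t\in\Lambda^\theta_+$ with $a+(n_a+n_\theta)t_\theta+t\in\mathbb N_0^{\Delta^+}$ the vector $w_{\lambda,a+(n_a+n_\theta)t_\theta+t}$ is nonzero, satisfies $\pi_{\lambda+\rho}(h)w=\mu_{\lambda,a}(h)w$ for all $h\in\mathfrak h$, and is an eigenvector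 of $\pi_{\lambda+\rho}(\mathrm{Cas}_\theta)_s$ with eigenvalue $$c_{\lambda,a,n_\theta}=\tfrac12\big(\mu_{\lambda,a}(h_\theta)-2(n_a+n_\theta)\big)\big(\mu_{\lambda,a}(h_\theta)-2(n_a+n_\theta+1)\big).$$ -/

import Mathlib

open scoped TensorProduct
open LieAlgebra LieAlgebra.IsKilling

noncomputable section

/-! ## The Weyl algebra with generators `x i`, `∂ i` -/

/-- The canonical commutation relations; `Sum.inl i` stands for `x i`, `Sum.inr i` for `∂ i`. -/
inductive WeylRel (ι : Type*) :
    FreeAlgebra ℂ (ι ⊕ ι) → FreeAlgebra ℂ (ι ⊕ ι) → Prop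
  | x_comm (i j : ι) : WeylRel ι
      (FreeAlgebra.ι ℂ (Sum.inl i) * FreeAlgebra.ι ℂ (Sum.inl j))
      (FreeAlgebra.ι ℂ (Sum.inl j) * FreeAlgebra.ι ℂ (Sum.inl i))
  | d_comm (i j : ι) : WeylRel ι
      (FreeAlgebra.ι ℂ (Sum.inr i) * FreeAlgebra.ι ℂ (Sum.inr j))
      (FreeAlgebra.ι ℂ (Sum.inr j) * FreeAlgebra.ι ℂ (Sum.inr i))
  | d_x_same (i : ι) : WeylRel ι
      (FreeAlgebra.ι ℂ (Sum.inr i) * FreeAlgebra.ι ℂ (Sum.inl i))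
      (FreeAlgebra.ι ℂ (Sum.inl i) * FreeAlgebra.ι ℂ (Sum.inr i) + 1)
  | d_x_ne (i j : ι) : i ≠ j → WeylRel ι
      (FreeAlgebra.ι ℂ (Sum.inr i) * FreeAlgebra.ι ℂ (Sum.inl j))
      (FreeAlgebra.ι ℂ (Sum.inl j) * FreeAlgebra.ι ℂ (Sum.inr i))

/-- The Weyl algebra `ℂ⟨x i, ∂ i⟩` in the variables `i : ι`. -/
abbrev WeylAlgebra (ι : Type*) : Type _ := RingQuot (WeylRel ι)

namespace WeylAlgebra

variable {ι : Type*}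

/-- The generator `x i`. -/
def x (i : ι) : WeylAlgebra ι :=
  RingQuot.mkAlgHom ℂ (WeylRel ι) (FreeAlgebra.ι ℂ (Sum.inl i))

/-- The generator `∂ i`. -/
def d (i : ι) : WeylAlgebra ι :=
  RingQuot.mkAlgHom ℂ (WeylRel ι) (FreeAlgebra.ι ℂ (Sum.inr i))

theorem x_mul_x (i j : ι) : (x i * x j : WeylAlgebra ι) = x j * x i := by
  simpa [x] using RingQuot.mkAlgHom_rel ℂ (WeylRel.x_comm i j)

theorem d_mul_d (i j : ι) : (d i * d j : WeylAlgebra ι) = d j * d i := by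
  simpa [d] using RingQuot.mkAlgHom_rel ℂ (WeylRel.d_comm i j)

theorem range_x_comm : ∀ p ∈ Set.range (x : ι → WeylAlgebra ι),
    ∀ q ∈ Set.range (x : ι → WeylAlgebra ι), p * q = q * p := by
  rintro _ ⟨i, rfl⟩ _ ⟨j, rfl⟩
  exact x_mul_x i j

/-- The homomorphism `ℂ[x] → ℂ⟨x, ∂⟩` sending each variable to the generator `x i`. -/
def ofPoly : MvPolynomial ι ℂ →ₐ[ℂ] WeylAlgebra ι :=
  haveI := Algebra.isMulCommutative_adjoin ℂ (range_x_comm (ι := ι))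
  letI : CommSemiring (Algebra.adjoin ℂ (Set.range (x : ι → WeylAlgebra ι))) :=
    { (Algebra.adjoin ℂ (Set.range (x : ι → WeylAlgebra ι))).toSemiring with
      mul_comm := fun p q => mul_comm' p q }
  (Algebra.adjoin ℂ (Set.range (x : ι → WeylAlgebra ι))).val.comp
    (MvPolynomial.aeval (R := ℂ) (S₁ := Algebra.adjoin ℂ (Set.range (x : ι → WeylAlgebra ι)))
      fun i => ⟨x i, Algebra.subset_adjoin ⟨i, rfl⟩⟩)

theorem ofPoly_X (i : ι) : ofPoly (MvPolynomial.X i) = x i := by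
  simp [ofPoly]

/-- The left ideal generated by the `x i` with `i ≠ j` together with `∂ j`. -/
def gtIdeal (j : ι) : Submodule (WeylAlgebra ι) (WeylAlgebra ι) :=
  Submodule.span (WeylAlgebra ι) ({p | ∃ i, i ≠ j ∧ p = x i} ∪ {d j})

/-- The quotient of the Weyl algebra by the left ideal `gtIdeal j`. -/
abbrev GTModule (j : ι) : Type _ := WeylAlgebra ι ⧸ gtIdeal j

/-- The operator on `GTModule j` by which an element of the Weyl algebra acts. -/
def op (j : ι) : WeylAlgebra ι →ₐ[ℂ] Module.End ℂ (GTModule j) :=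
  Algebra.lsmul ℂ ℂ (GTModule j)

open scoped Classical in
/-- The class of `∏_{i ≠ j} (∂ i)^(c i) * (x j)^(c j)` in `GTModule j`. -/
def gtVector [Fintype ι] (j : ι) (c : ι → ℕ) : GTModule j :=
  (gtIdeal j).mkQ
    ((Finset.univ.erase j).noncommProd (fun i => (d i : WeylAlgebra ι) ^ c i)
        (fun i _ k _ _ => Commute.pow_pow (d_mul_d i k) (c i) (c k))
      * x j ^ c j)

end WeylAlgebra

/-- An operator is locally nilpotent if every vector is killed by some power of it. -/
def IsLocallyNilpotent {V : Type*} [AddCommGroup V] [Module ℂ V] (T : Module.End ℂ V) : Prop :=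
  ∀ v : V, ∃ k : ℕ, (T ^ k) v = 0

/-- The value `∑ n, (coeff n φ) T ^ n` of a formal power series at a nilpotent endomorphism `T`. -/
def evalNilpotent {A M : Type*} [CommRing A] [Algebra ℂ A] [AddCommGroup M] [Module A M]
    (φ : PowerSeries ℂ) (T : Module.End A M) : Module.End A M :=
  ∑ n ∈ Finset.range (nilpotencyClass T), algebraMap ℂ A (PowerSeries.coeff n φ) • T ^ n

/-- The power series `z e^z / (e^z - 1)`, written as `e^z` divided by
`(e^z - 1) / z = ∑ n, z^n / (n+1)!`. -/
def toddSeries : PowerSeries ℂ :=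
  PowerSeries.exp ℂ * (PowerSeries.mk fun n => ((n + 1).factorial : ℂ)⁻¹)⁻¹

/-! ## Root data -/

section Roots

variable {L : Type*} [LieRing L] [LieAlgebra ℂ L] [FiniteDimensional ℂ L] [LieAlgebra.IsSimple ℂ L]
  {H : LieSubalgebra ℂ L} [H.IsCartanSubalgebra]

/-- The set `Δ⁺` of positive roots with respect to a base `Π = b.support` of the root system. -/
abbrev PosRoot (b : (rootSystem H).Base) : Type _ := {α : H.root // b.IsPos α}

instance (b : (rootSystem H).Base) : Fintype (PosRoot b) := Fintype.ofFinite _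

/-- A positive root as a linear form on `H`. -/
def PosRoot.form {b : (rootSystem H).Base} (α : PosRoot b) : Module.Dual ℂ H :=
  (rootSystem H).root α.1

/-- The coroot `h_α`. -/
def PosRoot.coroot {b : (rootSystem H).Base} (α : PosRoot b) : H :=
  (rootSystem H).coroot α.1

/-- The positive root `θ` is maximal: `θ + α` is not a root for any positive root `α`. -/
def IsMaximalRoot {b : (rootSystem H).Base} (θ : PosRoot b) : Prop :=
  ∀ α : PosRoot b, θ.form + α.form ∉ Set.range (rootSystem H).root

/-- A basis of `L` consisting of root vectors `f_α` (`α ∈ Δ⁺`) of weight `-α`, the simple coroots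
`h_α` (`α ∈ Π`), and root vectors `e_α` (`α ∈ Δ⁺`) of weight `α`. -/
structure RootBasis (b : (rootSystem H).Base) where
  basis : Module.Basis (PosRoot b ⊕ b.support ⊕ PosRoot b) ℂ L
  f_mem : ∀ α : PosRoot b, basis (Sum.inl α) ∈ rootSpace H (-(α.form : H → ℂ))
  h_eq : ∀ i : b.support, basis (Sum.inr (Sum.inl i)) = ((rootSystem H).coroot i : L)
  e_mem : ∀ α : PosRoot b, basis (Sum.inr (Sum.inr α)) ∈ rootSpace H (α.form : H → ℂ)

/-- The half sum `ρ` of the positive roots. -/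
def weylVector (b : (rootSystem H).Base) : Module.Dual ℂ H :=
  (1 / 2 : ℂ) • ∑ α : PosRoot b, α.form

/-- The coefficient `m_{α,i}` in `α = ∑_i m_{α,i} α_i`, where `Π = {α_i}`. -/
def simpleCoeff {b : (rootSystem H).Base} (α : PosRoot b) (i : b.support) : ℤ :=
  b.toWeightBasisInt.repr ((rootSystem H).rootSpanMem ℤ α.1) i

open scoped Classical in
/-- The element `t_α ∈ ℤ^{Δ⁺}` (used for `α ∉ Π`): its value at a simple root `α_i` is `m_{θ,i}`
if `α = θ` and `-m_{α,i}` otherwise; its value at `α` is `1`, and all other values are `0`. -/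
def tVec {b : (rootSystem H).Base} (θ α : PosRoot b) : PosRoot b → ℤ := fun β =>
  if hβ : β.1 ∈ b.support then
    (if α = θ then simpleCoeff α ⟨β.1, hβ⟩ else -simpleCoeff α ⟨β.1, hβ⟩)
  else if β = α then 1 else 0

open scoped Classical in
/-- The extension by zero of `a ∈ ℤ^Π` to an element of `ℤ^{Δ⁺}`. -/
def extendZero {b : (rootSystem H).Base} (a : b.support → ℤ) : PosRoot b → ℤ := fun β =>
  if hβ : β.1 ∈ b.support then a ⟨β.1, hβ⟩ else 0

open scoped Classical in
/-- The set `Λ₊^θ` of the sums `∑ n_α t_α` over `α ∈ Δ⁺ \ (Π ∪ {θ})` with `n_α ∈ ℕ`. -/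
def lambdaPlusTheta {b : (rootSystem H).Base} (θ : PosRoot b) : Set (PosRoot b → ℤ) :=
  {t | ∃ n : PosRoot b → ℕ,
    t = ∑ α ∈ Finset.univ.filter (fun α : PosRoot b => α ≠ θ ∧ α.1 ∉ b.support),
      n α • tVec θ α}

open scoped Classical in
/-- The linear form `-∑_{α ≠ θ} a_α α + a_θ θ + μ + θ` on `H`. -/
def gtWeight {b : (rootSystem H).Base} (θ : PosRoot b) (μ : Module.Dual ℂ H)
    (a : PosRoot b → ℤ) : Module.Dual ℂ H :=
  -(∑ α ∈ Finset.univ.erase θ, a α • α.form) + a θ • θ.form + μ + θ.form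

namespace RootBasis

variable {b : (rootSystem H).Base} (B : RootBasis b)

/-- The root vector `f_α`. -/
def f (α : PosRoot b) : L := B.basis (Sum.inl α)

/-- The root vector `e_α`. -/
def e (α : PosRoot b) : L := B.basis (Sum.inr (Sum.inr α))

/-- The basis `B` viewed as a `ℂ[x]`-basis of the Lie algebra `ℂ[x] ⊗ L`, where `x` is the family
of coordinates `x_α`, `α ∈ Δ⁺`. -/
def polyBasis : Module.Basis (PosRoot b ⊕ b.support ⊕ PosRoot b)
    (MvPolynomial (PosRoot b) ℂ) (MvPolynomial (PosRoot b) ℂ ⊗[ℂ] L) :=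
  B.basis.baseChange (MvPolynomial (PosRoot b) ℂ)

/-- The coordinate `[y]_α` of (the `n̄`-part of) `y ∈ ℂ[x] ⊗ L` along `f_α`. -/
def fCoord (α : PosRoot b) : MvPolynomial (PosRoot b) ℂ ⊗[ℂ] L →ₗ[MvPolynomial (PosRoot b) ℂ]
    MvPolynomial (PosRoot b) ℂ :=
  B.polyBasis.coord (Sum.inl α)

/-- The `n̄`-part of an element of `ℂ[x] ⊗ L`, with respect to `L = n̄ ⊕ H ⊕ n`. -/
def nbarPart : Module.End (MvPolynomial (PosRoot b) ℂ) (MvPolynomial (PosRoot b) ℂ ⊗[ℂ] L) :=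
  ∑ α : PosRoot b, (B.fCoord α).smulRight (1 ⊗ₜ[ℂ] B.f α)

/-- The value of (the `ℂ[x]`-linear extension of) `μ ∈ H*` at the `H`-part of an element of
`ℂ[x] ⊗ L`. -/
def hValue (μ : Module.Dual ℂ H) : MvPolynomial (PosRoot b) ℂ ⊗[ℂ] L →ₗ[MvPolynomial (PosRoot b) ℂ]
    MvPolynomial (PosRoot b) ℂ :=
  ∑ i : b.support, (MvPolynomial.C (μ ((rootSystem H).coroot i)) : MvPolynomial (PosRoot b) ℂ) •
    B.polyBasis.coord (Sum.inr (Sum.inl i))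

/-- The endomorphism `ad w` of `ℂ[x] ⊗ L`. -/
def adPoly (w : MvPolynomial (PosRoot b) ℂ ⊗[ℂ] L) :
    Module.End (MvPolynomial (PosRoot b) ℂ) (MvPolynomial (PosRoot b) ℂ ⊗[ℂ] L) :=
  LieAlgebra.ad (MvPolynomial (PosRoot b) ℂ) (MvPolynomial (PosRoot b) ℂ ⊗[ℂ] L) w

/-- For `w ∈ ℂ[x] ⊗ n̄` (so that `ad w` is nilpotent) and `μ ∈ H*`, the map sending `a ∈ L` to
`-∑_α [ (ad w e^{ad w} / (e^{ad w} - 1)) (e^{-ad w} a)_{n̄} ]_α ∂_α + μ((e^{-ad w} a)_H)`. -/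
def diffOp (w : MvPolynomial (PosRoot b) ℂ ⊗[ℂ] L) (μ : Module.Dual ℂ H) (a : L) :
    WeylAlgebra (PosRoot b) :=
  -(∑ α : PosRoot b,
      WeylAlgebra.ofPoly
        (B.fCoord α
          (evalNilpotent toddSeries (adPoly w)
            (B.nbarPart (evalNilpotent (PowerSeries.exp ℂ) (-adPoly w) (1 ⊗ₜ[ℂ] a))))) *
        WeylAlgebra.d α)
    + WeylAlgebra.ofPoly
        (B.hValue μ (evalNilpotent (PowerSeries.exp ℂ) (-adPoly w) (1 ⊗ₜ[ℂ] a)))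

/-- The element `u(x) = ∑_{α ∈ Δ⁺} x_α f_α`. -/
def u : MvPolynomial (PosRoot b) ℂ ⊗[ℂ] L :=
  ∑ α : PosRoot b, MvPolynomial.X α ⊗ₜ[ℂ] B.f α

open scoped Classical in
/-- The element `v(x) = ∑_{α ∈ Δ⁺, α ≠ θ} x_α f_α`. -/
def v (θ : PosRoot b) : MvPolynomial (PosRoot b) ℂ ⊗[ℂ] L :=
  ∑ α ∈ Finset.univ.erase θ, MvPolynomial.X α ⊗ₜ[ℂ] B.f α

/-- The map `π_μ : L → Weyl algebra`. -/
def piMap (μ : Module.Dual ℂ H) (a : L) : WeylAlgebra (PosRoot b) :=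
  B.diffOp B.u (μ + weylVector b) a

/-- The map `σ_μ : L → Weyl algebra`. -/
def sigmaMap (θ : PosRoot b) (μ : Module.Dual ℂ H) (a : L) : WeylAlgebra (PosRoot b) :=
  B.diffOp (B.v θ) (μ + weylVector b) a

/-- The element `½ σ_μ(h_θ) (σ_μ(h_θ) - 2)`. -/
def casS (θ : PosRoot b) (μ : Module.Dual ℂ H) : WeylAlgebra (PosRoot b) :=
  (1 / 2 : ℂ) • (B.sigmaMap θ μ (θ.coroot : L) * (B.sigmaMap θ μ (θ.coroot : L) - 2))

/-- The element `2 σ_μ(e_θ) σ_μ(f_θ)`. -/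
def casN (θ : PosRoot b) (μ : Module.Dual ℂ H) : WeylAlgebra (PosRoot b) :=
  2 * (B.sigmaMap θ μ (B.e θ) * B.sigmaMap θ μ (B.f θ))

end RootBasis

end Roots

/-- The Casimir element `e f + f e + ½ h²` in the enveloping algebra of the Lie subalgebra
spanned by an `sl₂`-triple `(e, h, f)`. -/
def casimirElement {L : Type*} [LieRing L] [LieAlgebra ℂ L] {h e f : L}
    (T : IsSl2Triple h e f) : UniversalEnvelopingAlgebra ℂ (T.toLieSubalgebra ℂ) :=
  let s := T.toLieSubalgebra ℂ
  let E : s := ⟨e, T.mem_toLieSubalgebra_iff.2 ⟨1, 0, 0, by simp⟩⟩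
  let F : s := ⟨f, T.mem_toLieSubalgebra_iff.2 ⟨0, 1, 0, by simp⟩⟩
  let K : s := ⟨h, T.mem_toLieSubalgebra_iff.2 ⟨0, 0, 1, by simp [T.lie_e_f]⟩⟩
  UniversalEnvelopingAlgebra.ι ℂ E * UniversalEnvelopingAlgebra.ι ℂ F
    + UniversalEnvelopingAlgebra.ι ℂ F * UniversalEnvelopingAlgebra.ι ℂ E
    + (1 / 2 : ℂ) • UniversalEnvelopingAlgebra.ι ℂ K ^ 2

end

noncomputable section

/-! Everything rests on splitting `u = v + x_θ f_θ`. Since `θ` is maximal, `f_θ` commutes with `n̄`,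
so `ad v` and `x_θ ad f_θ` commute and `e^{-ad u} = e^{-ad v} e^{-x_θ ad f_θ}`, while the Todd
operator, which is applied to elements of `ℂ[x] ⊗ n̄` only, is the same for `u` and `v`. From
`e^{-x_θ ad f_θ} e_θ = e_θ + x_θ h_θ - x_θ² f_θ` one gets (`diffOp_u_e`, `diffOp_u_coe_eq`,
`diffOp_u_f`) π(e_θ) = σ(e_θ) + x_θ σ(h_θ) + x_θ² ∂_θ, π(h_θ) = σ(h_θ) + 2 x_θ ∂_θ, π(f_θ) = σ(f_θ)
= -∂_θ. The operators σ(a) do not involve x_θ, hence commute with ∂_θ; σ(h_θ) is an Euler operator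
without a θ-term plus a constant, hence commutes with x_θ; and σ(e_θ) has weight 2 under π(h_θ) by
homogeneity of its coefficients. These relations alone give the `sl₂` relations for π on the span of
the triple, and all terms of the Casimir element that contain x_θ cancel (`sl2_casimir`). That π is
a representation of the whole Lie algebra is never needed.

The module `W` is a Fock space: a Fourier transform in the variables other than x_θ identifies it
with `ℂ[x]` and the vectors `w_c` with the monomials. So the `w_c` form a basis, on which x_α ∂_α
acts by -(c_α + 1) for α ≠ θ and x_θ ∂_θ by c_θ. Hence σ(h_θ) is diagonal and the first part of the
Casimir element is semisimple; the second part is -2 σ(e_θ) ∂_θ, a product of commuting factors with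
∂_θ locally nilpotent.

For the weights, the shifts by 1 add up to `2ρ - θ`, which turns the eigenvalue of π_{λ+ρ}(h) on
`w_c` into μ_{λ,c}(h). The vectors t_α lie in the kernel of the linear part of μ, so the weight
depends on `a` only, and c_θ = n_a + n_θ. Here `θ` must not be simple, which is where rank at least
2 enters; n_a exists because every simple root occurs in `θ`, by irreducibility of the root system
(`IsMaximalRoot.simpleCoeff_pos`). -/

theorem Finset.noncommProd_eq_map_prod {α M N : Type*} [CommMonoid M] [Monoid N] (g : M →* N)
    {s : Finset α} {f : α → M} {f' : α → N} (h : ∀ i ∈ s, f' i = g (f i)) (comm) :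
    s.noncommProd f' comm = g (∏ i ∈ s, f i) := by
  refine (Finset.noncommProd_congr rfl h comm).trans ?_
  refine (Finset.map_noncommProd s f (fun _ _ _ _ _ => Commute.all _ _) g).symm.trans ?_
  exact congrArg g (Finset.noncommProd_eq_prod s f)

/-! ### Weyl pairs and the universal property of the Weyl algebra -/

namespace WeylAlgebra

variable {ι : Type*}

theorem neg_mul_eq (p q : WeylAlgebra ι) : -p * q = -(p * q) := neg_mul p q

theorem mul_neg_eq (p q : WeylAlgebra ι) : p * -q = -(p * q) := mul_neg p q

theorem d_mul_x_self (i : ι) : (d i * x i : WeylAlgebra ι) = x i * d i + 1 := by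
  simpa [x, d] using RingQuot.mkAlgHom_rel ℂ (WeylRel.d_x_same i)

theorem d_mul_x_of_ne {i j : ι} (h : i ≠ j) : (d i * x j : WeylAlgebra ι) = x j * d i := by
  simpa [x, d] using RingQuot.mkAlgHom_rel ℂ (WeylRel.d_x_ne i j h)

open scoped Classical in
theorem d_mul_x (i j : ι) :
    (d i * x j : WeylAlgebra ι) = x j * d i + if i = j then 1 else 0 := by
  split_ifs with h
  · rw [h, d_mul_x_self]
  · rw [d_mul_x_of_ne h, add_zero]

open scoped Classical in
/-- Two families of elements of a ring that satisfy the canonical commutation relations. -/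
structure IsWeylPair {A : Type*} [Ring A] (y z : ι → A) : Prop where
  y_comm (i j : ι) : y i * y j = y j * y i
  z_comm (i j : ι) : z i * z j = z j * z i
  z_y (i j : ι) : z i * y j = y j * z i + if i = j then 1 else 0

namespace IsWeylPair

variable {A : Type*} [Ring A] {y z : ι → A}

theorem z_y_of_ne (h : IsWeylPair y z) {i j : ι} (hij : i ≠ j) : z i * y j = y j * z i := by
  rw [h.z_y, if_neg hij, add_zero]

open scoped Classical in
/-- The Fourier transform of a Weyl pair in the indices `i ≠ j`. -/
theorem fourier (h : IsWeylPair y z) (j : ι) :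
    IsWeylPair (fun i => if i = j then y i else z i) (fun i => if i = j then z i else -y i) where
  y_comm i k := by
    split_ifs with h₁ h₂ h₂
    · exact h.y_comm i k
    · rw [h.z_y_of_ne]; rintro rfl; exact h₂ h₁
    · rw [h.z_y_of_ne]; rintro rfl; exact h₁ h₂
    · exact h.z_comm i k
  z_comm i k := by
    split_ifs with h₁ h₂ h₂
    · exact h.z_comm i k
    · rw [mul_neg, neg_mul, h.z_y_of_ne]; rintro rfl; exact h₂ h₁
    · rw [mul_neg, neg_mul, h.z_y_of_ne]; rintro rfl; exact h₁ h₂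
    · rw [neg_mul_neg, neg_mul_neg, h.y_comm]
  z_y i k := by
    by_cases h₁ : i = j <;> by_cases h₂ : k = j
    · simpa [h₁, h₂] using h.z_y j j
    · simp [h₁, h₂, Ne.symm h₂, h.z_comm j k]
    · simp [h₁, h₂, h.y_comm i j]
    · simp only [h₁, h₂, if_false, neg_mul, mul_neg, h.z_y k i, eq_comm (a := k)]
      split_ifs <;> simp

open scoped Classical in
/-- The inverse Fourier transform of a Weyl pair in the indices `i ≠ j`. -/
theorem fourierInv (h : IsWeylPair y z) (j : ι) :
    IsWeylPair (fun i => if i = j then y i else -z i) (fun i => if i = j then z i else y i) where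
  y_comm i k := by
    split_ifs with h₁ h₂ h₂
    · exact h.y_comm i k
    · rw [mul_neg, neg_mul, h.z_y_of_ne]; rintro rfl; exact h₂ h₁
    · rw [mul_neg, neg_mul, h.z_y_of_ne]; rintro rfl; exact h₁ h₂
    · rw [neg_mul_neg, neg_mul_neg, h.z_comm]
  z_comm i k := by
    split_ifs with h₁ h₂ h₂
    · exact h.z_comm i k
    · rw [h.z_y_of_ne]; rintro rfl; exact h₂ h₁
    · rw [h.z_y_of_ne]; rintro rfl; exact h₁ h₂
    · exact h.y_comm i k
  z_y i k := by
    by_cases h₁ : i = j <;> by_cases h₂ : k = j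
    · simpa [h₁, h₂] using h.z_y j j
    · simp [h₁, h₂, Ne.symm h₂, h.z_comm j k]
    · simp [h₁, h₂, h.y_comm i j]
    · simp only [h₁, h₂, if_false, neg_mul, mul_neg, h.z_y k i, eq_comm (a := k)]
      split_ifs <;> simp

end IsWeylPair

theorem isWeylPair_x_d : IsWeylPair (x : ι → WeylAlgebra ι) d := ⟨x_mul_x, d_mul_d, d_mul_x⟩

/-- The homomorphism from the Weyl algebra given by a Weyl pair. -/
def lift {A : Type*} [Ring A] [Algebra ℂ A] {y z : ι → A} (h : IsWeylPair y z) :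
    WeylAlgebra ι →ₐ[ℂ] A :=
  RingQuot.liftAlgHom ℂ ⟨FreeAlgebra.lift ℂ (Sum.elim y z), by
    rintro _ _ (⟨i, j⟩ | ⟨i, j⟩ | i | ⟨i, j, hij⟩)
    · simpa using h.y_comm i j
    · simpa using h.z_comm i j
    · simpa using h.z_y i i
    · simpa using h.z_y_of_ne hij⟩

section Lift

variable {A : Type*} [Ring A] [Algebra ℂ A] {y z : ι → A} (h : IsWeylPair y z)

theorem lift_x (i : ι) : lift h (x i) = y i := by
  simp [lift, x]

theorem lift_d (i : ι) : lift h (d i) = z i := by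
  simp [lift, d]

end Lift

theorem adjoin_generators :
    Algebra.adjoin ℂ (Set.range (x : ι → WeylAlgebra ι) ∪ Set.range d) = ⊤ := by
  have h : Set.range (x : ι → WeylAlgebra ι) ∪ Set.range d =
      RingQuot.mkAlgHom ℂ (WeylRel ι) '' Set.range (FreeAlgebra.ι ℂ) := by
    ext p
    simp [x, d, or_and_right, exists_or]
  rw [h, ← AlgHom.map_adjoin, FreeAlgebra.adjoin_range_ι, Algebra.map_top,
    AlgHom.range_eq_top]
  exact RingQuot.mkAlgHom_surjective ℂ _

/-- A commutation rule with the variables extends to all polynomials. -/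
theorem mul_ofPoly (D : Derivation ℂ (MvPolynomial ι ℂ) (MvPolynomial ι ℂ)) (T : WeylAlgebra ι)
    (hT : ∀ i, T * x i = x i * T + ofPoly (D (MvPolynomial.X i))) (p : MvPolynomial ι ℂ) :
    T * ofPoly p = ofPoly p * T + ofPoly (D p) := by
  induction p using MvPolynomial.induction_on with
  | C a =>
    have h : (MvPolynomial.C a : MvPolynomial ι ℂ) = algebraMap ℂ _ a := rfl
    rw [h, AlgHom.commutes, Derivation.map_algebraMap, map_zero, add_zero, Algebra.commutes]
  | add p q hp hq => simp only [map_add, mul_add, add_mul, hp, hq]; abel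
  | mul_X p i hp =>
    rw [map_mul, ofPoly_X, ← mul_assoc, hp, add_mul, mul_assoc, hT, Derivation.leibniz, map_add,
      smul_eq_mul, smul_eq_mul, mul_comm (MvPolynomial.X i), map_mul, map_mul, ofPoly_X]
    simp only [mul_add, mul_assoc, add_assoc]

open scoped Classical in
theorem d_mul_ofPoly (i : ι) (p : MvPolynomial ι ℂ) :
    d i * ofPoly p = ofPoly p * d i + ofPoly (MvPolynomial.pderiv i p) := by
  refine mul_ofPoly _ _ (fun j => ?_) p
  rw [d_mul_x, MvPolynomial.pderiv_X, Pi.single_apply]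
  simp only [eq_comm (a := j)]
  split_ifs <;> simp

/-! ### The module `GTModule j` as a Fock space -/

section Fock

variable (j : ι)

/-- The endomorphism of the Weyl algebra that is the Fourier transform in the variables `i ≠ j`. -/
def fourier : WeylAlgebra ι →ₐ[ℂ] WeylAlgebra ι := lift (isWeylPair_x_d.fourier j)

theorem fourier_x_self : fourier j (x j) = x j := by simp [fourier, lift_x]

theorem fourier_d_self : fourier j (d j) = d j := by simp [fourier, lift_d]

variable {j}

theorem fourier_x {i : ι} (h : i ≠ j) : fourier j (x i) = d i := by simp [fourier, lift_x, h]

theorem fourier_d {i : ι} (h : i ≠ j) : fourier j (d i) = -x i := by simp [fourier, lift_d, h]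

/-- The transformed derivatives are, up to sign, the generators of the ideal, so the class of 1 in
`GTModule j` is a vacuum vector for them. -/
theorem fourier_d_mem (i : ι) : fourier j (d i) ∈ gtIdeal j := by
  by_cases h : i = j
  · subst h
    rw [fourier_d_self]
    exact Submodule.subset_span (Or.inr rfl)
  · rw [fourier_d h]
    exact neg_mem (Submodule.subset_span (Or.inl ⟨i, h, rfl⟩))

variable (j)

/-- The map from polynomials onto `GTModule j`, under which multiplication by a variable and partial
differentiation correspond to the Fourier transforms of the generators. -/
def fockMap : MvPolynomial ι ℂ →ₗ[ℂ] GTModule j :=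
  ((gtIdeal j).mkQ.restrictScalars ℂ).comp ((fourier j).comp ofPoly).toLinearMap

variable {j}

theorem fockMap_apply (p : MvPolynomial ι ℂ) :
    fockMap j p = (gtIdeal j).mkQ (fourier j (ofPoly p)) := rfl

theorem op_mkQ (a p : WeylAlgebra ι) : op j a ((gtIdeal j).mkQ p) = (gtIdeal j).mkQ (a * p) := rfl

theorem op_fourier_x (i : ι) (p : MvPolynomial ι ℂ) :
    op j (fourier j (x i)) (fockMap j p) = fockMap j (MvPolynomial.X i * p) := by
  rw [fockMap_apply, fockMap_apply, op_mkQ, map_mul ofPoly, map_mul (fourier j), ofPoly_X]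

theorem op_fourier_d (i : ι) (p : MvPolynomial ι ℂ) :
    op j (fourier j (d i)) (fockMap j p) = fockMap j (MvPolynomial.pderiv i p) := by
  rw [fockMap_apply, fockMap_apply, op_mkQ, ← map_mul (fourier j), d_mul_ofPoly, map_add, map_add,
    map_mul (fourier j), add_eq_right]
  rw [Submodule.mkQ_apply, Submodule.Quotient.mk_eq_zero]
  exact (gtIdeal j).smul_mem _ (fourier_d_mem i)

theorem op_x_self (p : MvPolynomial ι ℂ) :
    op j (x j) (fockMap j p) = fockMap j (MvPolynomial.X j * p) := by
  rw [← op_fourier_x, fourier_x_self]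

theorem op_d_self (p : MvPolynomial ι ℂ) :
    op j (d j) (fockMap j p) = fockMap j (MvPolynomial.pderiv j p) := by
  rw [← op_fourier_d, fourier_d_self]

theorem op_d {i : ι} (h : i ≠ j) (p : MvPolynomial ι ℂ) :
    op j (d i) (fockMap j p) = fockMap j (MvPolynomial.X i * p) := by
  rw [← op_fourier_x, fourier_x h]

theorem op_x {i : ι} (h : i ≠ j) (p : MvPolynomial ι ℂ) :
    op j (x i) (fockMap j p) = -fockMap j (MvPolynomial.pderiv i p) := by
  rw [← op_fourier_d, fourier_d h, map_neg, LinearMap.neg_apply, neg_neg]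

/-- The image contains the class of 1, which generates the module, and is stable under the
generators of the Weyl algebra. -/
theorem fockMap_surjective : Function.Surjective (fockMap j) := by
  have key : ∀ a ∈ Algebra.adjoin ℂ (Set.range (x : ι → WeylAlgebra ι) ∪ Set.range d),
      ∀ p, ∃ q, op j a (fockMap j p) = fockMap j q := by
    intro a ha
    induction ha using Algebra.adjoin_induction with
    | mem a ha =>
      intro p
      rcases ha with ⟨i, rfl⟩ | ⟨i, rfl⟩ <;> by_cases h : i = j
      · subst h; exact ⟨_, op_x_self p⟩
      · exact ⟨_, (op_x h p).trans (map_neg _ _).symm⟩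
      · subst h; exact ⟨_, op_d_self p⟩
      · exact ⟨_, op_d h p⟩
    | algebraMap r =>
      intro p
      exact ⟨r • p, by rw [AlgHom.commutes, map_smul]; rfl⟩
    | add a b _ _ ha hb =>
      intro p
      obtain ⟨q, hq⟩ := ha p
      obtain ⟨r, hr⟩ := hb p
      exact ⟨q + r, by rw [map_add, LinearMap.add_apply, hq, hr, map_add]⟩
    | mul a b _ _ ha hb =>
      intro p
      obtain ⟨q, hq⟩ := hb p
      obtain ⟨r, hr⟩ := ha q
      exact ⟨r, by rw [map_mul, Module.End.mul_apply, hq, hr]⟩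
  intro w
  obtain ⟨a, rfl⟩ := (gtIdeal j).mkQ_surjective w
  obtain ⟨q, hq⟩ := key a (adjoin_generators (ι := ι) ▸ Algebra.mem_top) 1
  refine ⟨q, ?_⟩
  rw [← hq, fockMap_apply, op_mkQ, map_one, map_one, mul_one]

theorem pderiv_comm (i k : ι) (p : MvPolynomial ι ℂ) :
    MvPolynomial.pderiv i (MvPolynomial.pderiv k p) =
      MvPolynomial.pderiv k (MvPolynomial.pderiv i p) := by
  classical
  have h : ⁅(MvPolynomial.pderiv i : Derivation ℂ (MvPolynomial ι ℂ) (MvPolynomial ι ℂ)),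
      (MvPolynomial.pderiv k : Derivation ℂ (MvPolynomial ι ℂ) (MvPolynomial ι ℂ))⁆ = 0 := by
    apply MvPolynomial.derivation_ext
    intro l
    rw [Derivation.commutator_apply, MvPolynomial.pderiv_X, MvPolynomial.pderiv_X,
      Pi.single_apply, Pi.single_apply]
    split_ifs <;> simp
  have := DFunLike.congr_fun h p
  rwa [Derivation.commutator_apply, Derivation.zero_apply, sub_eq_zero] at this

open scoped Classical in
theorem pderiv_X_mul (i k : ι) (p : MvPolynomial ι ℂ) :
    MvPolynomial.pderiv i (MvPolynomial.X k * p) =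
      MvPolynomial.X k * MvPolynomial.pderiv i p + if i = k then p else 0 := by
  rw [Derivation.leibniz, MvPolynomial.pderiv_X, Pi.single_apply]
  simp only [eq_comm (a := k), smul_eq_mul]
  congr 1
  split_ifs <;> simp

theorem isWeylPair_mulLeft_pderiv :
    IsWeylPair (A := Module.End ℂ (MvPolynomial ι ℂ))
      (fun i => LinearMap.mulLeft ℂ (MvPolynomial.X i))
      (fun i => (MvPolynomial.pderiv i).toLinearMap) where
  y_comm i k := by
    refine LinearMap.ext fun p => ?_
    rw [Module.End.mul_apply, Module.End.mul_apply]
    exact mul_left_comm (MvPolynomial.X i) (MvPolynomial.X k) p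
  z_comm i k := by
    refine LinearMap.ext fun p => ?_
    rw [Module.End.mul_apply, Module.End.mul_apply]
    exact pderiv_comm i k p
  z_y i k := by
    refine LinearMap.ext fun p => ?_
    rw [LinearMap.add_apply, Module.End.mul_apply, Module.End.mul_apply]
    refine (pderiv_X_mul i k p).trans ?_
    split_ifs <;> rfl

variable (j)

/-- The representation of the Weyl algebra on polynomials inverse to `fourier j`. -/
def fockRep : WeylAlgebra ι →ₐ[ℂ] Module.End ℂ (MvPolynomial ι ℂ) :=
  lift (isWeylPair_mulLeft_pderiv.fourierInv j)

variable {j}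

theorem fockRep_fourier_x (i : ι) :
    fockRep j (fourier j (x i)) = LinearMap.mulLeft ℂ (MvPolynomial.X i) := by
  by_cases h : i = j
  · subst h; simp [fourier_x_self, fockRep, lift_x]
  · simp [fourier_x h, fockRep, lift_d, h]

theorem fockRep_fourier_ofPoly (p : MvPolynomial ι ℂ) :
    fockRep j (fourier j (ofPoly p)) = LinearMap.mulLeft ℂ p := by
  have h : ((fockRep j).comp (fourier j)).comp ofPoly = Algebra.lmul ℂ (MvPolynomial ι ℂ) :=
    MvPolynomial.algHom_ext fun i => by
      rw [AlgHom.comp_apply, AlgHom.comp_apply, ofPoly_X, fockRep_fourier_x]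
      rfl
  exact DFunLike.congr_fun h p

/-- The generators of the ideal act on polynomials as partial derivatives up to sign, and these kill
constants. -/
theorem fockRep_apply_one_of_mem {a : WeylAlgebra ι} (ha : a ∈ gtIdeal j) : fockRep j a 1 = 0 := by
  induction ha using Submodule.span_induction with
  | mem a ha =>
    rcases ha with ⟨i, hi, rfl⟩ | rfl
    · simp [fockRep, lift_x, hi]
    · simp [fockRep, lift_d]
  | zero => simp
  | add a b _ _ ha hb => rw [map_add, LinearMap.add_apply, ha, hb, add_zero]
  | smul r a _ ha => rw [smul_eq_mul, map_mul, Module.End.mul_apply, ha, map_zero]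

/-- Evaluation of `fockRep j` at the constant 1 factors through the quotient and recovers `p` from
`fockMap j p`. -/
theorem fockMap_injective : Function.Injective (fockMap j) := by
  rw [injective_iff_map_eq_zero]
  intro p hp
  rw [fockMap_apply, Submodule.mkQ_apply, Submodule.Quotient.mk_eq_zero] at hp
  simpa [fockRep_fourier_ofPoly] using fockRep_apply_one_of_mem hp

theorem gtVector_eq_fockMap [Fintype ι] (c : ι → ℕ) :
    gtVector j c = fockMap j (MvPolynomial.monomial (Finsupp.equivFunOnFinite.symm c) 1) := by
  classical
  rw [fockMap_apply, gtVector]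
  congr 1
  rw [MvPolynomial.monomial_eq, map_one, one_mul,
    Finsupp.prod_fintype _ _ (fun _ => pow_zero _), ← Finset.prod_erase_mul _ _ (Finset.mem_univ j),
    map_mul ofPoly, map_mul (fourier j)]
  congr 1
  · refine Finset.noncommProd_eq_map_prod (((fourier j).comp ofPoly : MvPolynomial ι ℂ →ₐ[ℂ] WeylAlgebra ι) :
      MvPolynomial ι ℂ →* WeylAlgebra ι) ?_ _
    intro i hi
    change _ = fourier j (ofPoly _)
    rw [map_pow, map_pow, ofPoly_X, fourier_x (Finset.ne_of_mem_erase (by convert hi))]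
    rfl
  · rw [map_pow, map_pow, ofPoly_X, fourier_x_self]
    rfl

theorem gtVector_ne_zero [Fintype ι] (c : ι → ℕ) : gtVector j c ≠ 0 := by
  rw [gtVector_eq_fockMap, Ne, map_eq_zero_iff _ fockMap_injective, MvPolynomial.monomial_eq_zero]
  exact one_ne_zero

theorem span_gtVector [Fintype ι] : Submodule.span ℂ (Set.range (gtVector j)) = ⊤ := by
  rw [eq_top_iff]
  intro w _
  obtain ⟨p, rfl⟩ := fockMap_surjective w
  induction p using MvPolynomial.induction_on' with
  | monomial s a =>
    have h : MvPolynomial.monomial s a = a • MvPolynomial.monomial s (1 : ℂ) := by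
      rw [MvPolynomial.smul_monomial, smul_eq_mul, mul_one]
    rw [h, map_smul]
    refine Submodule.smul_mem _ _ (Submodule.subset_span ⟨s, ?_⟩)
    rw [gtVector_eq_fockMap]
    congr
    ext
    rfl
  | add p q hp hq => rw [map_add]; exact add_mem (hp trivial) (hq trivial)

theorem X_mul_pderiv_monomial (i : ι) (s : ι →₀ ℕ) :
    MvPolynomial.X i * MvPolynomial.pderiv i (MvPolynomial.monomial s (1 : ℂ)) =
      (s i : ℂ) • MvPolynomial.monomial s 1 := by
  rw [MvPolynomial.X_mul_pderiv_monomial, Nat.cast_smul_eq_nsmul]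

theorem op_x_mul_d_self [Fintype ι] (c : ι → ℕ) :
    op j (x j * d j) (gtVector j c) = (c j : ℂ) • gtVector j c := by
  rw [map_mul, Module.End.mul_apply, gtVector_eq_fockMap, op_d_self, op_x_self,
    X_mul_pderiv_monomial, map_smul]
  rfl

/-- After the Fourier transform `x i * d i` becomes `-∂ i x i = -(x i ∂ i + 1)`, which accounts for
the sign and the shift by 1. -/
theorem op_x_mul_d [Fintype ι] {i : ι} (h : i ≠ j) (c : ι → ℕ) :
    op j (x i * d i) (gtVector j c) = (-((c i : ℂ) + 1)) • gtVector j c := by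
  rw [map_mul, Module.End.mul_apply, gtVector_eq_fockMap, op_d h, op_x h, Derivation.leibniz,
    smul_eq_mul, X_mul_pderiv_monomial, MvPolynomial.pderiv_X_self, smul_eq_mul, mul_one, map_add,
    map_smul]
  change -((c i : ℂ) • fockMap j _ + fockMap j _) = _
  module

/-- `∂ j` is locally nilpotent on `GTModule j`. -/
theorem exists_op_d_pow_eq_zero (w : GTModule j) : ∃ k : ℕ, (op j (d j) ^ k) w = 0 := by
  obtain ⟨p, rfl⟩ := fockMap_surjective w
  have hpow : ∀ (k l : ℕ) (w : GTModule j), (op j (d j) ^ k) w = 0 →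
      (op j (d j) ^ (l + k)) w = 0 := fun k l w h => by
    rw [pow_add, Module.End.mul_apply, h, map_zero]
  induction p using MvPolynomial.induction_on' with
  | monomial s a =>
    suffices ∀ (n : ℕ) (s : ι →₀ ℕ) (a : ℂ), s j = n →
        (op j (d j) ^ (n + 1)) (fockMap j (MvPolynomial.monomial s a)) = 0 from ⟨_, this _ s a rfl⟩
    intro n
    induction n with
    | zero =>
      intro s a hs
      rw [zero_add, pow_one, op_d_self, MvPolynomial.pderiv_monomial, hs]
      simp
    | succ n ih =>
      intro s a hs
      rw [pow_succ, Module.End.mul_apply, op_d_self, MvPolynomial.pderiv_monomial]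
      exact ih _ _ (by simp [hs])
  | add p q hp hq =>
    obtain ⟨k, hk⟩ := hp
    obtain ⟨l, hl⟩ := hq
    exact ⟨l + k, by rw [map_add, map_add, hpow k l _ hk, add_comm l, hpow l k _ hl, add_zero]⟩

/-- Since the factors commute, the powers of the product are `a ^ k * d j ^ k`, and `d j ^ k`
already kills the given vector for large `k`. -/
theorem isLocallyNilpotent_op {a : WeylAlgebra ι} (h : Commute a (d j)) :
    IsLocallyNilpotent (op j (a * d j)) := by
  intro w
  obtain ⟨k, hk⟩ := exists_op_d_pow_eq_zero w
  exact ⟨k, by rw [← map_pow, h.mul_pow, map_mul, map_pow, map_pow, Module.End.mul_apply, hk,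
    map_zero]⟩

end Fock

/-! ### Euler operators -/

section Euler

/-- The derivation `∑ i, s i • x i ∂ i` of the polynomial ring. -/
def eulerDer (s : ι → ℂ) : Derivation ℂ (MvPolynomial ι ℂ) (MvPolynomial ι ℂ) :=
  MvPolynomial.mkDerivation ℂ fun i => s i • MvPolynomial.X i

theorem eulerDer_X (s : ι → ℂ) (i : ι) :
    eulerDer s (MvPolynomial.X i) = s i • MvPolynomial.X i :=
  MvPolynomial.mkDerivation_X ..

variable [Fintype ι]

/-- The operator `∑ i, s i • x i ∂ i`. -/
def euler (s : ι → ℂ) : WeylAlgebra ι := ∑ i, s i • (x i * d i)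

theorem euler_mul_x (s : ι → ℂ) (i : ι) : euler s * x i = x i * euler s + s i • x i := by
  classical
  simp only [euler, Finset.sum_mul, Finset.mul_sum, smul_mul_assoc, mul_smul_comm, mul_assoc,
    d_mul_x, mul_add, smul_add, Finset.sum_add_distrib]
  congr 1
  · exact Finset.sum_congr rfl fun k _ => by rw [← mul_assoc, x_mul_x, mul_assoc]
  · simp [mul_ite]

theorem euler_mul_d (s : ι → ℂ) (i : ι) : euler s * d i = d i * euler s - s i • d i := by
  classical
  rw [eq_sub_iff_add_eq]
  simp only [euler, Finset.sum_mul, Finset.mul_sum, smul_mul_assoc, mul_smul_comm, ← mul_assoc,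
    d_mul_x, add_mul, smul_add, Finset.sum_add_distrib]
  congr 1
  · exact Finset.sum_congr rfl fun k _ => by rw [mul_assoc, d_mul_d, mul_assoc]
  · simp [ite_mul]

theorem euler_mul_ofPoly (s : ι → ℂ) (p : MvPolynomial ι ℂ) :
    euler s * ofPoly p = ofPoly p * euler s + ofPoly (eulerDer s p) :=
  mul_ofPoly _ _ (fun i => by rw [euler_mul_x, eulerDer_X, map_smul, ofPoly_X]) p

open scoped Classical in
theorem op_euler (j : ι) (s : ι → ℂ) (c : ι → ℕ) :
    op j (euler s) (gtVector j c) =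
      (-(∑ i ∈ Finset.univ.erase j, s i * (c i + 1)) + s j * c j) • gtVector j c := by
  have h : ∀ i, op j (s i • (x i * d i)) (gtVector j c) =
      (if i = j then s j * c j else -(s i * (c i + 1))) • gtVector j c := by
    intro i
    rw [map_smul, LinearMap.smul_apply]
    split_ifs with hi
    · rw [hi, op_x_mul_d_self]
      module
    · rw [op_x_mul_d hi]
      module
  rw [euler, map_sum, LinearMap.sum_apply, Finset.sum_congr rfl fun i _ => h i]
  refine (Finset.sum_smul (R := ℂ) (M := GTModule j)).symm.trans ?_
  congr 1
  rw [← Finset.sum_erase_add _ _ (Finset.mem_univ j), if_pos rfl, ← Finset.sum_neg_distrib]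
  congr 1
  exact Finset.sum_congr rfl fun i hi => if_neg (Finset.ne_of_mem_erase hi)

end Euler

end WeylAlgebra

/-- An endomorphism is semisimple if its eigenvectors span. -/
theorem Module.End.isSemisimple_of_span_eigenvectors {K V κ : Type*} [Field K] [AddCommGroup V]
    [Module K V] (T : Module.End K V) (v : κ → V) (hv : Submodule.span K (Set.range v) = ⊤)
    (μ : κ → K) (hT : ∀ i, T (v i) = μ i • v i) : T.IsSemisimple := by
  have hmul : ∀ (i : κ) (r : Polynomial K),
      r • Module.AEval'.of T (v i) = Module.AEval'.of T (r.eval (μ i) • v i) := by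
    intro i r
    rw [← Module.AEval.of_aeval_smul]
    congr 1
    induction r using Polynomial.induction_on' with
    | add p q hp hq => rw [map_add, add_smul, hp, hq, Polynomial.eval_add, add_smul]
    | monomial n a =>
      have : ∀ n : ℕ, (T ^ n) (v i) = μ i ^ n • v i := by
        intro n
        induction n with
        | zero => simp
        | succ n ih => rw [pow_succ', Module.End.mul_apply, ih, map_smul, hT, smul_smul, pow_succ]
      simp [Polynomial.aeval_monomial, this, mul_smul]
  -- Semisimplicity is checked for the `K[X]`-module attached to `T`: each `v i` generates a zero or
  -- simple submodule, and these submodules span.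
  refine isSemisimpleModule_of_isSemisimpleModule_submodule'
    (p := fun i => Submodule.span (Polynomial K) {Module.AEval'.of T (v i)}) (fun i => ?_) ?_
  · by_cases hi : v i = 0
    · rw [hi, map_zero, Submodule.span_zero_singleton]
      exact (isSemisimpleModule_iff _ _).2 Subsingleton.instComplementedLattice
    · have : IsSimpleModule (Polynomial K)
          (Submodule.span (Polynomial K) {Module.AEval'.of T (v i)}) := by
        rw [isSimpleModule_iff_isAtom]
        refine ⟨by simpa using hi, fun N hN => ?_⟩
        by_contra hN₀
        obtain ⟨n, hn, hn₀⟩ := N.ne_bot_iff.1 hN₀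
        obtain ⟨r, rfl⟩ := Submodule.mem_span_singleton.1 (hN.le hn)
        rw [hmul] at hn hn₀
        have hr : r.eval (μ i) ≠ 0 := fun h => hn₀ (by rw [h, zero_smul, map_zero])
        -- A nonzero element of `N` is `r(μ i) • v i` with an invertible scalar, so `N` contains `v
        -- i` itself.
        refine hN.not_ge ((Submodule.span_singleton_le_iff_mem _ _).2 ?_)
        have := N.smul_mem (Polynomial.C (r.eval (μ i))⁻¹) hn
        rwa [Module.AEval.C_smul, map_smul, smul_smul, inv_mul_cancel₀ hr, one_smul] at this
      infer_instance
  · rw [eq_top_iff]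
    intro w _
    obtain ⟨w, rfl⟩ := (Module.AEval'.of T).surjective w
    have hw : w ∈ Submodule.span K (Set.range v) := hv ▸ Submodule.mem_top
    induction hw using Submodule.span_induction with
    | mem w hw =>
      obtain ⟨i, rfl⟩ := hw
      exact Submodule.mem_iSup_of_mem i (Submodule.mem_span_singleton_self _)
    | zero => rw [map_zero]; exact zero_mem _
    | add a b _ _ ha hb => rw [map_add]; exact add_mem (ha trivial) (hb trivial)
    | smul r a _ ha =>
      rw [map_smul, ← Module.AEval.C_smul]
      exact Submodule.smul_mem _ _ (ha trivial)

/-! ### Power series in nilpotent endomorphisms -/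

section EvalNilpotent

variable {A M : Type*} [CommRing A] [Algebra ℂ A] [AddCommGroup M] [Module A M]
  {S T : Module.End A M} (φ ψ : PowerSeries ℂ)

/-- Any vanishing exponent `K` may replace the nilpotency class, so several series can be truncated
at the same order. -/
theorem evalNilpotent_eq_aeval {K : ℕ} (hK : T ^ K = 0) :
    evalNilpotent φ T =
      Polynomial.aeval T ((PowerSeries.trunc K φ).map (algebraMap ℂ A)) := by
  have h : evalNilpotent φ T =
      ∑ n ∈ Finset.range K, algebraMap ℂ A (PowerSeries.coeff n φ) • T ^ n := by
    refine Finset.sum_subset (Finset.range_mono (csInf_le' hK)) fun n _ hn => ?_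
    rw [pow_eq_zero_of_le (not_lt.1 (mt Finset.mem_range.2 hn)) (pow_nilpotencyClass ⟨K, hK⟩),
      smul_zero]
  rw [h, Polynomial.aeval_def, Polynomial.eval₂_map, PowerSeries.eval₂_trunc_eq_sum_range]
  exact Finset.sum_congr rfl fun n _ => Algebra.smul_def _ _

theorem evalNilpotent_apply (hT : IsNilpotent T) {K : ℕ} {m : M} (hm : (T ^ K) m = 0) :
    evalNilpotent φ T m =
      ∑ n ∈ Finset.range K, algebraMap ℂ A (PowerSeries.coeff n φ) • (T ^ n) m := by
  have key : ∀ {k l : ℕ}, k ≤ l → (T ^ k) m = 0 →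
      ∑ n ∈ Finset.range l, algebraMap ℂ A (PowerSeries.coeff n φ) • (T ^ n) m =
        ∑ n ∈ Finset.range k, algebraMap ℂ A (PowerSeries.coeff n φ) • (T ^ n) m := by
    intro k l hkl hk
    refine (Finset.sum_subset (Finset.range_mono hkl) fun n _ hn => ?_).symm
    obtain ⟨i, rfl⟩ := Nat.exists_eq_add_of_le' (not_lt.1 (mt Finset.mem_range.2 hn))
    rw [pow_add, Module.End.mul_apply, hk, map_zero, smul_zero]
  have h : (T ^ nilpotencyClass T) m = 0 := by rw [pow_nilpotencyClass hT, LinearMap.zero_apply]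
  rw [← key (le_max_right (nilpotencyClass T) K) hm, key (le_max_left _ _) h, evalNilpotent,
    LinearMap.sum_apply]
  rfl

omit [Algebra ℂ A] in
theorem isNilpotent_neg_end (hT : IsNilpotent T) : IsNilpotent (-T) := by
  obtain ⟨K, hK⟩ := hT
  exact ⟨K, by rw [neg_pow, hK, mul_zero]⟩

variable {φ ψ}

/-- The truncation of the product and the product of the truncations agree below degree `K`; their
difference is divisible by `X ^ K` and vanishes at `T`. -/
theorem evalNilpotent_mul (hT : IsNilpotent T) :
    evalNilpotent (φ * ψ) T = evalNilpotent φ T * evalNilpotent ψ T := by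
  obtain ⟨K, hK⟩ := hT
  rw [evalNilpotent_eq_aeval _ hK, evalNilpotent_eq_aeval _ hK, evalNilpotent_eq_aeval _ hK,
    ← map_mul, ← Polynomial.map_mul, ← sub_eq_zero, ← map_sub, ← Polynomial.map_sub]
  have h : Polynomial.X ^ K ∣ PowerSeries.trunc K (φ * ψ) -
      PowerSeries.trunc K φ * PowerSeries.trunc K ψ := by
    rw [Polynomial.X_pow_dvd_iff]
    intro n hn
    rw [Polynomial.coeff_sub, PowerSeries.coeff_trunc, if_pos hn,
      PowerSeries.coeff_mul_eq_coeff_trunc_mul_trunc _ _ hn, ← Polynomial.coe_mul,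
      Polynomial.coeff_coe, sub_self]
  obtain ⟨q, hq⟩ := h
  rw [hq, Polynomial.map_mul, map_mul, Polynomial.map_pow, Polynomial.map_X, map_pow,
    Polynomial.aeval_X, hK, zero_mul]

theorem evalNilpotent_sub (hT : IsNilpotent T) :
    evalNilpotent (φ - ψ) T = evalNilpotent φ T - evalNilpotent ψ T := by
  obtain ⟨K, hK⟩ := hT
  rw [evalNilpotent_eq_aeval _ hK, evalNilpotent_eq_aeval _ hK, evalNilpotent_eq_aeval _ hK,
    map_sub, Polynomial.map_sub, map_sub]

theorem evalNilpotent_neg (hT : IsNilpotent T) :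
    evalNilpotent (-φ) T = -evalNilpotent φ T := by
  obtain ⟨K, hK⟩ := hT
  rw [evalNilpotent_eq_aeval _ hK, evalNilpotent_eq_aeval _ hK,
    map_neg, Polynomial.map_neg, map_neg]

theorem evalNilpotent_one (hT : IsNilpotent T) : evalNilpotent 1 T = 1 := by
  obtain ⟨K, hK⟩ := hT
  -- The order of truncation is raised by one so that the constant term survives even for `K = 0`.
  rw [evalNilpotent_eq_aeval (K := K + 1) _ (by rw [pow_succ, hK, zero_mul]),
    PowerSeries.trunc_one, Polynomial.map_one, map_one]

theorem evalNilpotent_X (hT : IsNilpotent T) : evalNilpotent PowerSeries.X T = T := by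
  obtain ⟨K, hK⟩ := hT
  rw [evalNilpotent_eq_aeval (K := K + 2) _ (by rw [pow_add, hK, zero_mul]),
    PowerSeries.trunc_X, Polynomial.map_X, Polynomial.aeval_X]

theorem evalNilpotent_apply_of_apply_eq_zero (hT : IsNilpotent T) {m : M} (hm : T m = 0) :
    evalNilpotent φ T m = algebraMap ℂ A (PowerSeries.constantCoeff φ) • m := by
  rw [evalNilpotent_apply φ hT (K := 1) (by rwa [pow_one])]
  simp

variable (φ)

theorem evalNilpotent_neg_right (hT : IsNilpotent T) :
    evalNilpotent φ (-T) = evalNilpotent (PowerSeries.evalNegHom φ) T := by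
  obtain ⟨K, hK⟩ := hT
  have hK' : (-T) ^ K = 0 := by rw [neg_pow, hK, mul_zero]
  ext m
  rw [evalNilpotent_apply _ ⟨K, hK⟩ (by rw [hK, LinearMap.zero_apply]),
    evalNilpotent_apply _ ⟨K, hK'⟩ (by rw [hK', LinearMap.zero_apply])]
  refine Finset.sum_congr rfl fun n _ => ?_
  rw [PowerSeries.evalNegHom, PowerSeries.coeff_rescale, map_mul, mul_comm, mul_smul]
  congr 1
  rcases Nat.even_or_odd n with h | h <;> simp [h.neg_pow]

/-- A power series in a nilpotent endomorphism only depends on its restriction to an invariant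
submodule when it is applied to elements of that submodule. -/
theorem evalNilpotent_apply_congr (hS : IsNilpotent S) (hT : IsNilpotent T) {N : Submodule A M}
    (hN : ∀ m ∈ N, T m ∈ N) (h : ∀ m ∈ N, S m = T m) {m : M} (hm : m ∈ N) :
    evalNilpotent φ S m = evalNilpotent φ T m := by
  have hpow : ∀ n : ℕ, (T ^ n) m ∈ N ∧ (S ^ n) m = (T ^ n) m := by
    intro n
    induction n with
    | zero => exact ⟨hm, rfl⟩
    | succ n ih =>
      rw [pow_succ', pow_succ', Module.End.mul_apply, Module.End.mul_apply, ih.2]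
      exact ⟨hN _ ih.1, h _ ih.1⟩
  obtain ⟨K, hK⟩ := hT
  rw [evalNilpotent_apply φ hS (K := K) (by rw [(hpow K).2, hK, LinearMap.zero_apply]),
    evalNilpotent_apply φ ⟨K, hK⟩ (K := K) (by rw [hK, LinearMap.zero_apply])]
  exact Finset.sum_congr rfl fun n _ => by rw [(hpow n).2]

theorem evalNilpotent_apply_sub_mem {N : Submodule A M} (hT : IsNilpotent T)
    (hN : ∀ m ∈ N, T m ∈ N) {m : M} (hm : T m ∈ N) :
    evalNilpotent φ T m - algebraMap ℂ A (PowerSeries.constantCoeff φ) • m ∈ N := by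
  have hpow : ∀ n : ℕ, (T ^ (n + 1)) m ∈ N := by
    intro n
    induction n with
    | zero => simpa using hm
    | succ n ih => rw [pow_succ', Module.End.mul_apply]; exact hN _ ih
  obtain ⟨K, hK⟩ := hT
  rw [evalNilpotent_apply φ ⟨K, hK⟩ (K := K + 1)
    (by rw [pow_succ, hK, zero_mul, LinearMap.zero_apply]), Finset.sum_range_succ']
  simpa using N.sum_mem fun n _ => N.smul_mem _ (hpow n)

/-- An additive map that commutes with `T` and with complex scalars commutes with power series
in `T`. -/
theorem map_evalNilpotent_apply (hT : IsNilpotent T) (δ : M →+ M)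
    (hδ : ∀ m, δ (T m) = T (δ m)) (hc : ∀ (c : ℂ) m, δ (algebraMap ℂ A c • m) =
      algebraMap ℂ A c • δ m) (m : M) :
    δ (evalNilpotent φ T m) = evalNilpotent φ T (δ m) := by
  have hpow : ∀ n : ℕ, δ ((T ^ n) m) = (T ^ n) (δ m) := by
    intro n
    induction n with
    | zero => rfl
    | succ n ih => rw [pow_succ', Module.End.mul_apply, hδ, ih]; rfl
  obtain ⟨K, hK⟩ := hT
  rw [evalNilpotent_apply φ ⟨K, hK⟩ (K := K) (by rw [hK, LinearMap.zero_apply]),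
    evalNilpotent_apply φ ⟨K, hK⟩ (K := K) (by rw [hK, LinearMap.zero_apply]), map_sum]
  exact Finset.sum_congr rfl fun n _ => by rw [hc, hpow]

theorem evalNilpotent_exp_add (hS : IsNilpotent S) (hT : IsNilpotent T) (h : Commute S T) :
    evalNilpotent (PowerSeries.exp ℂ) (S + T) =
      evalNilpotent (PowerSeries.exp ℂ) S * evalNilpotent (PowerSeries.exp ℂ) T := by
  -- Scalars are restricted along `ℚ → ℂ → A`, so that `IsNilpotent.exp` has literally the same
  -- coefficients `1 / n!`.
  let _ : Module ℚ (Module.End A M) :=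
    Module.compHom _ ((algebraMap ℂ A).comp (algebraMap ℚ ℂ))
  have key : ∀ U : Module.End A M, evalNilpotent (PowerSeries.exp ℂ) U = IsNilpotent.exp U := by
    intro U
    refine Finset.sum_congr rfl fun n _ => ?_
    rw [PowerSeries.coeff_exp, one_div]
    rfl
  rw [key, key, key, IsNilpotent.exp_add_of_commute h hS hT]

theorem evalNilpotent_exp_neg_add (hS : IsNilpotent S) (hT : IsNilpotent T) (h : Commute S T) :
    evalNilpotent (PowerSeries.exp ℂ) (-(S + T)) =
      evalNilpotent (PowerSeries.exp ℂ) (-S) * evalNilpotent (PowerSeries.exp ℂ) (-T) := by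
  rw [neg_add, evalNilpotent_exp_add hS.neg hT.neg h.neg_left.neg_right]

/-- This is `z e^z / (e^z - 1) · (e^{-z} - 1) = -z`, with the division by `z` carried out in `E =
(e^z - 1) / z`, an invertible series. -/
theorem toddSeries_mul :
    toddSeries * (PowerSeries.evalNegHom (PowerSeries.exp ℂ) - 1) = -PowerSeries.X := by
  set E : PowerSeries ℂ := PowerSeries.mk fun n => ((n + 1).factorial : ℂ)⁻¹ with hE
  have h₁ : PowerSeries.exp ℂ - 1 = PowerSeries.X * E := by
    ext n
    cases n with
    | zero => simp
    | succ n => simp [hE, PowerSeries.coeff_succ_X_mul, PowerSeries.coeff_exp, PowerSeries.coeff_one]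
  have h₂ : E * E⁻¹ = 1 := PowerSeries.mul_inv_cancel _ (by simp [hE])
  calc toddSeries * (PowerSeries.evalNegHom (PowerSeries.exp ℂ) - 1)
      = E⁻¹ * (PowerSeries.exp ℂ * PowerSeries.evalNegHom (PowerSeries.exp ℂ) -
          PowerSeries.exp ℂ) := by rw [toddSeries]; ring
    _ = E⁻¹ * -(PowerSeries.exp ℂ - 1) := by rw [PowerSeries.exp_mul_exp_neg_eq_one]; ring
    _ = -PowerSeries.X * (E * E⁻¹) := by rw [h₁]; ring
    _ = -PowerSeries.X := by rw [h₂, mul_one]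

theorem constantCoeff_toddSeries : PowerSeries.constantCoeff toddSeries = 1 := by
  simp [toddSeries]

/-- This is what makes the vector field attached to a Cartan element linear in `x`: the Todd series
undoes the exponential up to its first-order term. -/
theorem evalNilpotent_toddSeries_exp_sub (hT : IsNilpotent T) (m : M) :
    evalNilpotent toddSeries T (evalNilpotent (PowerSeries.exp ℂ) (-T) m - m) = -T m := by
  have h := evalNilpotent_mul (φ := toddSeries)
    (ψ := PowerSeries.evalNegHom (PowerSeries.exp ℂ) - 1) hT
  rw [toddSeries_mul, evalNilpotent_neg hT, evalNilpotent_X hT, evalNilpotent_sub hT,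
    evalNilpotent_one hT, ← evalNilpotent_neg_right _ hT] at h
  exact (LinearMap.congr_fun h m).symm

omit [Algebra ℂ A] in
/-- An endomorphism that strictly lowers a height function on a finite basis is nilpotent. -/
theorem isNilpotent_of_height_lt {κ : Type*} [Finite κ] (v : Module.Basis κ A M) (ht : κ → ℤ)
    (h : ∀ j k, v.repr (T (v j)) k ≠ 0 → ht k < ht j) : IsNilpotent T := by
  have := Fintype.ofFinite κ
  have key : ∀ (n : ℕ) (j k : κ), v.repr ((T ^ n) (v j)) k ≠ 0 → ht k + n ≤ ht j := by
    intro n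
    induction n with
    | zero =>
      intro j k hk
      rw [pow_zero, Module.End.one_apply, v.repr_self, Finsupp.single_apply_ne_zero] at hk
      simp [hk.1]
    | succ n ih =>
      intro j k hk
      rw [pow_succ, Module.End.mul_apply, ← v.sum_repr (T (v j)), map_sum, map_sum,
        Finsupp.finsetSum_apply] at hk
      obtain ⟨l, -, hl⟩ := Finset.exists_ne_zero_of_sum_ne_zero hk
      rw [map_smul, map_smul, Finsupp.smul_apply, smul_eq_mul] at hl
      have h₁ := h j l (left_ne_zero_of_mul hl)
      have h₂ := ih l k (right_ne_zero_of_mul hl)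
      push_cast
      omega
  obtain ⟨a, ha⟩ := (Set.finite_range ht).bddBelow
  obtain ⟨c, hc⟩ := (Set.finite_range ht).bddAbove
  -- All heights lie in `[a, c]`, so `c - a + 1` strict descents are impossible.
  refine ⟨(c - a + 1).toNat, v.ext fun j => ?_⟩
  rw [LinearMap.zero_apply, ← v.repr.map_eq_zero_iff]
  ext k
  by_contra hk
  have h₁ := key _ j k hk
  have h₂ := ha ⟨k, rfl⟩
  have h₃ := hc ⟨j, rfl⟩
  omega

end EvalNilpotent

/-! ### The maximal root -/

section Roots

variable {L : Type*} [LieRing L] [LieAlgebra ℂ L] [FiniteDimensional ℂ L] [LieAlgebra.IsSimple ℂ L]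
  {H : LieSubalgebra ℂ L} [H.IsCartanSubalgebra] {b : (rootSystem H).Base}

theorem PosRoot.form_eq_sum (α : PosRoot b) :
    α.form = ∑ i : b.support, simpleCoeff α i • (rootSystem H).root i := by
  have h := congrArg (Subtype.val : _ → Module.Dual ℂ H)
    (b.toWeightBasisInt.sum_repr ((rootSystem H).rootSpanMem ℤ α.1))
  simp only [Submodule.coe_sum, Submodule.coe_smul, b.coe_toWeightBasisInt_apply] at h
  exact h.symm

theorem simpleCoeff_eq_of_form_eq {α : PosRoot b} {g : b.support → ℤ}
    (h : α.form = ∑ i : b.support, g i • (rootSystem H).root i) : simpleCoeff α = g := by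
  rw [α.form_eq_sum] at h
  exact funext fun i => Fintype.linearIndependent_iffₛ.mp
    (b.linearIndepOn_root.restrict_scalars' ℤ) _ _ h i

theorem simpleCoeff_of_mem_support {α : PosRoot b} (h : α.1 ∈ b.support) {i : b.support}
    (hi : i.1 ≠ α.1) : simpleCoeff α i = 0 := by
  classical
  rw [simpleCoeff_eq_of_form_eq (g := Pi.single ⟨α.1, h⟩ 1)]
  · exact Pi.single_eq_of_ne (fun h => hi (congrArg Subtype.val h)) _
  · rw [Finset.sum_eq_single_of_mem ⟨α.1, h⟩ (Finset.mem_univ _)]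
    · rw [Pi.single_eq_same, one_smul]
      rfl
    · intro k _ hk
      rw [Pi.single_eq_of_ne hk, zero_smul]

theorem simpleCoeff_nonneg (α : PosRoot b) (i : b.support) : 0 ≤ simpleCoeff α i := by
  obtain ⟨f, -, hf⟩ := b.exists_root_eq_sum_nat_or_neg α.1
  have hpos : 0 < b.height α.1 := α.2
  have hf' : (rootSystem H).root α.1 = ∑ j ∈ b.support, f j • (rootSystem H).root j := by
    refine hf.resolve_right fun h => ?_
    have : b.height α.1 = ∑ j ∈ b.support, -(f j : ℤ) :=
      RootPairing.Base.height_eq_sum (by rw [h, ← Finset.sum_neg_distrib]; simp)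
    rw [this] at hpos
    exact hpos.not_ge (Finset.sum_nonpos fun j _ => by simp)
  rw [simpleCoeff_eq_of_form_eq (g := fun i => (f i.1 : ℤ))]
  · positivity
  · simp only [natCast_zsmul]
    rw [Finset.sum_coe_sort b.support fun j => f j • (rootSystem H).root j]
    exact hf'

/-- A negative pairing would make `θ + α_k` a root, against maximality, unless `θ = -α_k`, which
positivity excludes. -/
theorem IsMaximalRoot.pairingIn_nonneg {θ : PosRoot b} (hθ : IsMaximalRoot θ) (k : b.support) :
    0 ≤ (rootSystem H).pairingIn ℤ θ.1 k := by
  by_contra! h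
  have hk : b.IsPos k := RootPairing.Base.isPos_of_mem_support k.2
  refine hθ ⟨k, hk⟩ ((rootSystem H).root_add_root_mem_of_pairingIn_neg h fun h => ?_)
  -- Writing `-α_k = α_k - 2 α_k` gives `θ` the height `1 - 2 = -1`.
  have hz := b.height_add_zsmul (i := k.1) (j := k.1) (k := θ.1) (z := -2) (by rw [h]; module)
  rw [RootPairing.Base.height_one_of_mem_support k.2] at hz
  have : 0 < b.height θ.1 := θ.2
  norm_num at hz
  omega

/-- All simple roots occur in the maximal root. -/
theorem IsMaximalRoot.simpleCoeff_pos {θ : PosRoot b} (hθ : IsMaximalRoot θ) (i : b.support) :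
    0 < simpleCoeff θ i := by
  by_contra! hi
  replace hi : simpleCoeff θ i = 0 := le_antisymm hi (simpleCoeff_nonneg θ i)
  set J : Set b.support := {j | simpleCoeff θ j ≠ 0} with hJ
  -- For `k` outside the support `J` of `θ`, the pairing of `θ` with `α_k` is nonnegative by
  -- maximality, yet a sum of nonpositive terms; hence every term vanishes.
  have hpair : ∀ k ∉ J, ∀ j ∈ J, (rootSystem H).pairing j k = 0 := by
    intro k hk j hj
    have hsum : (rootSystem H).pairingIn ℤ θ.1 k =
        ∑ j : b.support, simpleCoeff θ j * (rootSystem H).pairingIn ℤ j k := by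
      apply FaithfulSMul.algebraMap_injective ℤ ℂ
      rw [RootPairing.algebraMap_pairingIn, ← RootPairing.root_coroot_eq_pairing, ← PosRoot.form,
        θ.form_eq_sum, map_sum, LinearMap.sum_apply, map_sum]
      refine Finset.sum_congr rfl fun j _ => ?_
      rw [map_zsmul, LinearMap.smul_apply, map_mul, RootPairing.algebraMap_pairingIn,
        RootPairing.root_coroot_eq_pairing, zsmul_eq_mul]
      rfl
    have hle : ∀ j ∈ (Finset.univ : Finset b.support),
        simpleCoeff θ j * (rootSystem H).pairingIn ℤ j k ≤ 0 := by
      intro j _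
      by_cases hjk : j.1 = k.1
      · have : simpleCoeff θ j = 0 := by
          rw [Subtype.ext hjk]
          exact not_not.1 hk
        rw [this, zero_mul]
      · exact mul_nonpos_of_nonneg_of_nonpos (simpleCoeff_nonneg θ j)
          (b.pairingIn_le_zero_of_ne hjk j.2 k.2)
    have hz := (Finset.sum_eq_zero_iff_of_nonpos hle).1
      (le_antisymm (Finset.sum_nonpos hle) (hsum ▸ hθ.pairingIn_nonneg k)) j (Finset.mem_univ j)
    rw [← (rootSystem H).algebraMap_pairingIn ℤ, (mul_eq_zero.1 hz).resolve_left hj, map_zero]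
  -- The span of the simple roots in `J` is stable under all simple reflections and contains `θ ≠
  -- 0`. By irreducibility it is everything, which contradicts the linear independence of the simple
  -- roots as `i ∉ J`.
  set q : Submodule ℂ (Module.Dual ℂ H) :=
    Submodule.span ℂ ((fun j : b.support => (rootSystem H).root j) '' J) with hq
  have hmem : (rootSystem H).root θ.1 ∈ q := by
    rw [← PosRoot.form, θ.form_eq_sum]
    refine Submodule.sum_mem _ fun j _ => ?_
    by_cases hj : j ∈ J
    · have hjq : (rootSystem H).root j ∈ q := Submodule.subset_span (Set.mem_image_of_mem _ hj)
      exact zsmul_mem hjq _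
    · rw [not_not.1 hj, zero_smul]
      exact zero_mem _
  have hinv : ∀ k ∈ b.support, q ∈ Module.End.invtSubmodule ((rootSystem H).reflection k) := by
    intro k hk
    by_cases hkJ : (⟨k, hk⟩ : b.support) ∈ J
    · have hkq : (rootSystem H).root k ∈ q := 
        Submodule.subset_span (Set.mem_image_of_mem _ hkJ)
      exact Submodule.mem_invtSubmodule_reflection_of_mem _ _ hkq
    · rw [Module.End.mem_invtSubmodule, hq, Submodule.span_le]
      rintro _ ⟨j, hj, rfl⟩
      rw [Submodule.comap_coe, Set.mem_preimage, LinearEquiv.coe_coe,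
        RootPairing.reflection_apply_root, hpair _ hkJ j hj, zero_smul, sub_zero]
      exact Submodule.subset_span ⟨j, hj, rfl⟩
  have htop : q = ⊤ := RootPairing.IsIrreducible.eq_top_of_invtSubmodule_reflection
    (P := rootSystem H) q ((b.forall_mem_support_invtSubmodule_iff q).1 hinv)
    (fun h => (rootSystem H).ne_zero θ.1 (by rwa [h, Submodule.mem_bot] at hmem))
  exact (b.linearIndepOn_root.linearIndependent.notMem_span_image (s := J) (x := i)
    (not_not.2 hi)) (by
      have h : (rootSystem H).root i ∈ q := htop ▸ Submodule.mem_top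
      exact h)

/-- If `θ` were simple, any other simple root, and there is one in rank at least 2, would have
coefficient 0 in it. -/
theorem IsMaximalRoot.notMem_support {θ : PosRoot b} (hθ : IsMaximalRoot θ)
    (hrank : 2 ≤ Module.finrank ℂ H) : θ.1 ∉ b.support := by
  intro h
  have hcard : 2 ≤ Fintype.card b.support := by
    rwa [← Module.finrank_eq_card_basis b.toWeightBasis, Subspace.dual_finrank_eq]
  have : Nontrivial b.support := Fintype.one_lt_card_iff_nontrivial.1 hcard
  obtain ⟨i, hi⟩ := exists_ne (⟨θ.1, h⟩ : b.support)
  exact (hθ.simpleCoeff_pos i).ne'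
    (simpleCoeff_of_mem_support h fun h => hi (Subtype.ext h))

/-! ### Weights -/

open scoped Classical in
/-- The linear part of `gtWeight`. -/
def gtLinear (θ : PosRoot b) : (PosRoot b → ℤ) →+ Module.Dual ℂ H where
  toFun a := -(∑ α ∈ Finset.univ.erase θ, a α • α.form) + a θ • θ.form
  map_zero' := by simp
  map_add' a c := by
    simp only [Pi.add_apply, add_smul, Finset.sum_add_distrib]
    abel

open scoped Classical in
theorem gtLinear_apply (θ : PosRoot b) (a : PosRoot b → ℤ) :
    gtLinear θ a = -(∑ α ∈ Finset.univ.erase θ, a α • α.form) + a θ • θ.form := rfl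

theorem gtWeight_eq (θ : PosRoot b) (μ : Module.Dual ℂ H) (a : PosRoot b → ℤ) :
    gtWeight θ μ a = gtLinear θ a + μ + θ.form := rfl

open scoped Classical in
theorem gtLinear_single_self (θ : PosRoot b) : gtLinear θ (Pi.single θ 1) = θ.form := by
  rw [gtLinear_apply]
  rw [Finset.sum_eq_zero, neg_zero, zero_add, Pi.single_eq_same, one_smul]
  intro α hα
  rw [Pi.single_eq_of_ne (Finset.ne_of_mem_erase hα), zero_smul]

open scoped Classical in
theorem gtLinear_single {θ α : PosRoot b} (h : α ≠ θ) :
    gtLinear θ (Pi.single α 1) = -α.form := by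
  rw [gtLinear_apply]
  rw [Finset.sum_eq_single_of_mem α (Finset.mem_erase.2 ⟨h, Finset.mem_univ _⟩),
    Pi.single_eq_same, one_smul, Pi.single_eq_of_ne h.symm, zero_smul, add_zero]
  intro β _ hβ
  rw [Pi.single_eq_of_ne hβ, zero_smul]

theorem gtLinear_extendZero {θ : PosRoot b} (hθ : θ.1 ∉ b.support) (a : b.support → ℤ) :
    gtLinear θ (extendZero a) = -∑ i : b.support, a i • (rootSystem H).root i := by
  classical
  rw [gtLinear_apply]
  have h₀ : extendZero a θ = 0 := dif_neg hθ
  rw [h₀, zero_smul, add_zero]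
  congr 1
  symm
  refine Finset.sum_of_injOn
    (fun i : b.support => (⟨i.1, RootPairing.Base.isPos_of_mem_support i.2⟩ : PosRoot b))
    (fun i _ k _ h => Subtype.ext (congrArg (fun β : PosRoot b => β.1) h)) ?_ ?_ ?_
  · intro i _
    refine Finset.mem_coe.2 (Finset.mem_erase.2 ⟨?_, Finset.mem_univ _⟩)
    rintro rfl
    exact hθ i.2
  · intro β _ hβ
    have : β.1 ∉ b.support := fun h => hβ ⟨⟨β.1, h⟩, Finset.mem_coe.2 (Finset.mem_univ _), rfl⟩
    rw [extendZero, dif_neg this, zero_smul]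
  · intro i _
    rw [extendZero, dif_pos i.2]
    rfl

open scoped Classical in
theorem tVec_eq {θ α : PosRoot b} (hα : α.1 ∉ b.support) :
    tVec θ α = extendZero (if α = θ then simpleCoeff α else -simpleCoeff α) + Pi.single α 1 := by
  ext β
  rw [tVec, Pi.add_apply, extendZero, Pi.single_apply]
  by_cases hβ : β.1 ∈ b.support
  · have h : β ≠ α := by rintro rfl; exact hα hβ
    rw [dif_pos hβ, dif_pos hβ, if_neg h, add_zero]
    split_ifs <;> rfl
  · rw [dif_neg hβ, dif_neg hβ, zero_add]

/-- The entry 1 at `α` is compensated by the simple-root entries. The sign is opposite for `α = θ`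
because `θ` alone enters `gtLinear` with a plus sign. -/
theorem gtLinear_tVec {θ α : PosRoot b} (hθ : θ.1 ∉ b.support) (hα : α.1 ∉ b.support) :
    gtLinear θ (tVec θ α) = 0 := by
  classical
  rw [tVec_eq hα, map_add, gtLinear_extendZero hθ]
  by_cases h : α = θ
  · subst h
    rw [if_pos rfl, gtLinear_single_self, ← α.form_eq_sum, neg_add_cancel]
  · rw [if_neg h, gtLinear_single h]
    simp only [Pi.neg_apply, neg_smul, Finset.sum_neg_distrib, neg_neg]
    rw [← α.form_eq_sum, add_neg_cancel]

theorem tVec_apply_self {θ α : PosRoot b} (hθ : θ.1 ∉ b.support) (h : α ≠ θ) :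
    tVec θ α θ = 0 := by
  rw [tVec, dif_neg hθ, if_neg h.symm]

theorem tVec_self_apply_self {θ : PosRoot b} (hθ : θ.1 ∉ b.support) : tVec θ θ θ = 1 := by
  rw [tVec, dif_neg hθ, if_pos rfl]

theorem gtLinear_eq_zero_of_mem {θ : PosRoot b} (hθ : θ.1 ∉ b.support) {t : PosRoot b → ℤ}
    (ht : t ∈ lambdaPlusTheta θ) : gtLinear θ t = 0 := by
  obtain ⟨n, rfl⟩ := ht
  rw [map_sum]
  refine Finset.sum_eq_zero fun α hα => ?_
  replace hα : α ≠ θ ∧ α.1 ∉ b.support := by simpa using hα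
  rw [map_nsmul, gtLinear_tVec hθ hα.2, smul_zero]

theorem apply_self_eq_zero_of_mem {θ : PosRoot b} (hθ : θ.1 ∉ b.support) {t : PosRoot b → ℤ}
    (ht : t ∈ lambdaPlusTheta θ) : t θ = 0 := by
  obtain ⟨n, rfl⟩ := ht
  rw [Finset.sum_apply]
  refine Finset.sum_eq_zero fun α hα => ?_
  replace hα : α ≠ θ ∧ α.1 ∉ b.support := by simpa using hα
  rw [Pi.smul_apply, tVec_apply_self hθ hα.1, smul_zero]

theorem IsMaximalRoot.exists_isLeast {θ : PosRoot b} (hθ : IsMaximalRoot θ)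
    (a : b.support → ℤ) :
    ∃ na : ℕ, IsLeast {n : ℕ | 0 ≤ extendZero a + n • tVec θ θ} na := by
  classical
  have hne : {n : ℕ | 0 ≤ extendZero a + n • tVec θ θ}.Nonempty := by
    -- As every coefficient of `θ` is at least 1, this multiple of `t_θ` outweighs all negative
    -- entries of `a`.
    refine ⟨∑ i, (a i).natAbs, fun β => ?_⟩
    rw [Pi.add_apply, Pi.smul_apply, extendZero, tVec]
    split_ifs with hβ h
    · have h₁ := hθ.simpleCoeff_pos ⟨β.1, hβ⟩
      have h₂ : (a ⟨β.1, hβ⟩).natAbs ≤ ∑ i, (a i).natAbs :=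
        Finset.single_le_sum (f := fun i => (a i).natAbs) (fun _ _ => Nat.zero_le _)
          (Finset.mem_univ _)
      rw [nsmul_eq_mul, Pi.zero_apply]
      have h₃ : ((a ⟨β.1, hβ⟩).natAbs : ℤ) ≤ (∑ i, (a i).natAbs : ℕ) := by exact_mod_cast h₂
      nlinarith [neg_abs_le (a ⟨β.1, hβ⟩), Int.natCast_natAbs (a ⟨β.1, hβ⟩)]
    · exact absurd rfl h
    · rw [zero_add]
      exact nsmul_nonneg zero_le_one _
    · simp
  exact ⟨_, Nat.sInf_mem hne, fun _ h => Nat.sInf_le h⟩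

end Roots

/-! ### The triangular decomposition -/

section Roots

variable {L : Type*} [LieRing L] [LieAlgebra ℂ L] [FiniteDimensional ℂ L] [LieAlgebra.IsSimple ℂ L]
  {H : LieSubalgebra ℂ L} [H.IsCartanSubalgebra] {b : (rootSystem H).Base}

/-- There is an element of the Cartan subalgebra on which every root takes its height as value. -/
theorem exists_height_element (b : (rootSystem H).Base) :
    ∃ ρ : H, ∀ α : PosRoot b, α.form ρ = (b.height α.1 : ℂ) := by
  refine ⟨(Module.evalEquiv ℂ H).symm (b.toWeightBasis.constr ℂ fun _ => (1 : ℂ)), fun α => ?_⟩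
  obtain ⟨g, -, -, hg⟩ := b.exists_root_eq_sum_int α.1
  have h : ∀ j ∈ b.support, b.toWeightBasis.constr ℂ (fun _ => (1 : ℂ)) ((rootSystem H).root j) =
      1 := fun j hj => by
    rw [← b.toWeightBasis_apply ⟨j, hj⟩, Module.Basis.constr_basis]
  rw [Module.apply_evalEquiv_symm_apply, RootPairing.Base.height_eq_sum hg, PosRoot.form, hg,
    map_sum, Int.cast_sum]
  refine Finset.sum_congr rfl fun j hj => ?_
  rw [map_zsmul, h j hj, zsmul_eq_mul, mul_one]

namespace RootBasis

variable (B : RootBasis b)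

/-- The weight of a basis vector. -/
def wt : PosRoot b ⊕ b.support ⊕ PosRoot b → Module.Dual ℂ H :=
  Sum.elim (fun α => -α.form) (Sum.elim 0 fun α => α.form)

/-- The height of a basis vector. -/
def ht : PosRoot b ⊕ b.support ⊕ PosRoot b → ℤ :=
  Sum.elim (fun α => -b.height α.1) (Sum.elim 0 fun α => b.height α.1)

theorem ht_inl_neg (α : PosRoot b) : ht (Sum.inl α) < 0 := neg_neg_of_pos α.2

theorem ht_inr_inr_pos (α : PosRoot b) : 0 < ht (Sum.inr (Sum.inr α)) := α.2

theorem ht_inr_nonneg (k : b.support ⊕ PosRoot b) : 0 ≤ ht (Sum.inr k) := by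
  rcases k with k | α
  · exact le_rfl
  · exact (ht_inr_inr_pos α).le

theorem lie_basis (h : H) (j : PosRoot b ⊕ b.support ⊕ PosRoot b) :
    ⁅(h : L), B.basis j⁆ = wt j h • B.basis j := by
  rcases j with α | i | α
  · exact lie_eq_smul_of_mem_rootSpace (B.f_mem α) h
  · rw [B.h_eq, ← LieSubalgebra.coe_bracket, trivial_lie_zero]
    simp [wt]
  · exact lie_eq_smul_of_mem_rootSpace (B.e_mem α) h

theorem repr_lie (h : H) (y : L) (k : PosRoot b ⊕ b.support ⊕ PosRoot b) :
    B.basis.repr ⁅(h : L), y⁆ k = wt k h * B.basis.repr y k := by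
  classical
  have H : (B.basis.coord k).comp (LieAlgebra.ad ℂ L (h : L)) =
      wt k h • B.basis.coord k := by
    refine B.basis.ext fun j => ?_
    simp only [LinearMap.comp_apply, LinearMap.smul_apply, Module.Basis.coord_apply,
      LieAlgebra.ad_apply]
    rw [B.lie_basis, map_smul, Finsupp.smul_apply, B.basis.repr_self, Finsupp.single_apply]
    split_ifs with hjk
    · rw [hjk]
    · simp
  exact LinearMap.congr_fun H y

theorem wt_eq_of_repr_ne_zero {h : H} {y : L} {c : ℂ} (hy : ⁅(h : L), y⁆ = c • y)
    {k : PosRoot b ⊕ b.support ⊕ PosRoot b} (hk : B.basis.repr y k ≠ 0) : wt k h = c := by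
  have := B.repr_lie h y k
  rw [hy, map_smul, Finsupp.smul_apply, smul_eq_mul] at this
  exact (mul_right_cancel₀ hk this).symm

/-- The height of a basis vector is its eigenvalue under the height element, and eigenvalues add
under the bracket. -/
theorem ht_eq_of_repr_lie_f_ne_zero {α : PosRoot b} {j k : PosRoot b ⊕ b.support ⊕ PosRoot b}
    (hk : B.basis.repr ⁅B.f α, B.basis j⁆ k ≠ 0) : ht k = ht j - b.height α.1 := by
  obtain ⟨ρ, hρ⟩ := exists_height_element b
  have hwt : ∀ j : PosRoot b ⊕ b.support ⊕ PosRoot b, wt j ρ = (ht j : ℂ) := by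
    rintro (α | i | α) <;> simp [wt, ht, hρ]
  have h : ⁅(ρ : L), ⁅B.f α, B.basis j⁆⁆ = ((ht j - b.height α.1 : ℤ) : ℂ) • ⁅B.f α, B.basis j⁆ := by
    rw [leibniz_lie, B.lie_basis, f, B.lie_basis, smul_lie, lie_smul, ← add_smul, hwt, hwt]
    congr 1
    push_cast [ht]
    simp only [Sum.elim_inl]
    push_cast
    ring
  have := B.wt_eq_of_repr_ne_zero h hk
  rw [hwt] at this
  exact_mod_cast this

theorem polyBasis_apply (j : PosRoot b ⊕ b.support ⊕ PosRoot b) :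
    B.polyBasis j = 1 ⊗ₜ[ℂ] B.basis j :=
  Module.Basis.baseChange_apply ..

theorem polyBasis_repr_tmul (p : MvPolynomial (PosRoot b) ℂ) (y : L)
    (k : PosRoot b ⊕ b.support ⊕ PosRoot b) :
    B.polyBasis.repr (p ⊗ₜ[ℂ] y) k = B.basis.repr y k • p :=
  Module.Basis.baseChange_repr_tmul ..

theorem fCoord_apply (α : PosRoot b) (y : MvPolynomial (PosRoot b) ℂ ⊗[ℂ] L) :
    B.fCoord α y = B.polyBasis.repr y (Sum.inl α) := rfl

/-- The partial sum `∑_{α ∈ S} x_α f_α` of `u`. -/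
def uSum (S : Finset (PosRoot b)) : MvPolynomial (PosRoot b) ℂ ⊗[ℂ] L :=
  ∑ α ∈ S, MvPolynomial.X α ⊗ₜ[ℂ] B.f α

theorem adPoly_uSum_tmul (S : Finset (PosRoot b)) (p : MvPolynomial (PosRoot b) ℂ) (y : L) :
    adPoly (B.uSum S) (p ⊗ₜ[ℂ] y) =
      ∑ α ∈ S, (MvPolynomial.X α * p) ⊗ₜ[ℂ] ⁅B.f α, y⁆ := by
  rw [adPoly, uSum, map_sum, LinearMap.sum_apply]
  rfl

theorem ht_lt_of_repr_adPoly_ne_zero {S : Finset (PosRoot b)}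
    {j k : PosRoot b ⊕ b.support ⊕ PosRoot b}
    (hk : B.polyBasis.repr (adPoly (B.uSum S) (B.polyBasis j)) k ≠ 0) : ht k < ht j := by
  rw [polyBasis_apply, adPoly_uSum_tmul, map_sum, Finsupp.finsetSum_apply] at hk
  obtain ⟨α, -, hα⟩ := Finset.exists_ne_zero_of_sum_ne_zero hk
  rw [polyBasis_repr_tmul] at hα
  rw [B.ht_eq_of_repr_lie_f_ne_zero (left_ne_zero_of_smul hα)]
  have : 0 < b.height α.1 := α.2
  omega

theorem isNilpotent_adPoly_uSum (S : Finset (PosRoot b)) : IsNilpotent (adPoly (B.uSum S)) :=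
  isNilpotent_of_height_lt B.polyBasis ht fun _ _ => B.ht_lt_of_repr_adPoly_ne_zero

/-- The `ℂ[x]`-submodule `ℂ[x] ⊗ n̄`. -/
def nbar : Submodule (MvPolynomial (PosRoot b) ℂ) (MvPolynomial (PosRoot b) ℂ ⊗[ℂ] L) :=
  ⨅ k, LinearMap.ker (B.polyBasis.coord (Sum.inr k))

theorem mem_nbar {y : MvPolynomial (PosRoot b) ℂ ⊗[ℂ] L} :
    y ∈ B.nbar ↔ ∀ k, B.polyBasis.repr y (Sum.inr k) = 0 := by
  simp [nbar]

theorem eq_sum_of_mem_nbar {y : MvPolynomial (PosRoot b) ℂ ⊗[ℂ] L} (hy : y ∈ B.nbar) :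
    y = ∑ α, B.fCoord α y • (1 ⊗ₜ[ℂ] B.f α) := by
  conv_lhs => rw [← B.polyBasis.sum_repr y, Fintype.sum_sum_type]
  rw [Finset.sum_eq_zero (s := (Finset.univ : Finset (b.support ⊕ PosRoot b)))
    (fun k _ => by rw [B.mem_nbar.1 hy k, zero_smul]), add_zero]
  exact Finset.sum_congr rfl fun α _ => by rw [polyBasis_apply]; rfl

theorem tmul_f_mem_nbar (p : MvPolynomial (PosRoot b) ℂ) (α : PosRoot b) :
    p ⊗ₜ[ℂ] B.f α ∈ B.nbar := by
  rw [mem_nbar]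
  intro k
  rw [polyBasis_repr_tmul, f, B.basis.repr_self, Finsupp.single_eq_of_ne (by simp), zero_smul]

theorem adPoly_uSum_mem_nbar (S : Finset (PosRoot b)) {y : MvPolynomial (PosRoot b) ℂ ⊗[ℂ] L}
    (hy : y ∈ B.nbar) : adPoly (B.uSum S) y ∈ B.nbar := by
  rw [B.eq_sum_of_mem_nbar hy, map_sum]
  refine Submodule.sum_mem _ fun α _ => ?_
  rw [map_smul]
  refine Submodule.smul_mem _ _ (B.mem_nbar.2 fun k => ?_)
  by_contra hk
  have h := B.ht_lt_of_repr_adPoly_ne_zero (j := Sum.inl α) (by rw [polyBasis_apply]; exact hk)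
  have h₁ := ht_inl_neg α
  have h₂ := ht_inr_nonneg k
  omega

theorem repr_nbarPart_inl (y : MvPolynomial (PosRoot b) ℂ ⊗[ℂ] L) (α : PosRoot b) :
    B.polyBasis.repr (B.nbarPart y) (Sum.inl α) = B.polyBasis.repr y (Sum.inl α) := by
  rw [nbarPart, LinearMap.sum_apply, map_sum, Finsupp.finsetSum_apply,
    Finset.sum_eq_single_of_mem α (Finset.mem_univ _)]
  · rw [LinearMap.smulRight_apply, map_smul, Finsupp.smul_apply, polyBasis_repr_tmul, f,
      B.basis.repr_self, Finsupp.single_eq_same, one_smul, smul_eq_mul, mul_one]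
    rfl
  · intro β _ hβ
    rw [LinearMap.smulRight_apply, map_smul, Finsupp.smul_apply, polyBasis_repr_tmul, f,
      B.basis.repr_self, Finsupp.single_eq_of_ne (by simpa using hβ.symm), zero_smul, smul_zero]

theorem nbarPart_mem_nbar (y : MvPolynomial (PosRoot b) ℂ ⊗[ℂ] L) : B.nbarPart y ∈ B.nbar := by
  rw [nbarPart, LinearMap.sum_apply]
  exact Submodule.sum_mem _ fun α _ => Submodule.smul_mem _ _ (B.tmul_f_mem_nbar _ _)

theorem nbarPart_of_mem_nbar {y : MvPolynomial (PosRoot b) ℂ ⊗[ℂ] L} (hy : y ∈ B.nbar) :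
    B.nbarPart y = y := by
  conv_rhs => rw [B.eq_sum_of_mem_nbar hy]
  rw [nbarPart, LinearMap.sum_apply]
  rfl

/-- The height element kills `h` but acts by a nonzero scalar on each basis vector of nonzero
height. -/
theorem repr_coe (h : H) {k : PosRoot b ⊕ b.support ⊕ PosRoot b} (hk : ht k ≠ 0) :
    B.basis.repr (h : L) k = 0 := by
  obtain ⟨ρ, hρ⟩ := exists_height_element b
  by_contra hne
  have h₀ : ⁅(ρ : L), (h : L)⁆ = (0 : ℂ) • (h : L) := by
    rw [← LieSubalgebra.coe_bracket, trivial_lie_zero, zero_smul]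
    rfl
  have := B.wt_eq_of_repr_ne_zero h₀ hne
  rcases k with α | i | α
  · simp [wt, hρ] at this
    exact hk (by simp [ht, this])
  · exact hk rfl
  · simp [wt, hρ] at this
    exact hk (by simp [ht, this])

theorem nbarPart_coe (h : H) : B.nbarPart (1 ⊗ₜ[ℂ] (h : L)) = 0 := by
  rw [nbarPart, LinearMap.sum_apply]
  refine Finset.sum_eq_zero fun α _ => ?_
  rw [LinearMap.smulRight_apply, fCoord_apply, polyBasis_repr_tmul,
    B.repr_coe h (ht_inl_neg α).ne, zero_smul, zero_smul]

theorem hValue_of_mem_nbar (μ : Module.Dual ℂ H) {y : MvPolynomial (PosRoot b) ℂ ⊗[ℂ] L}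
    (hy : y ∈ B.nbar) : B.hValue μ y = 0 := by
  rw [hValue, LinearMap.sum_apply]
  refine Finset.sum_eq_zero fun i _ => ?_
  rw [LinearMap.smul_apply, Module.Basis.coord_apply, B.mem_nbar.1 hy, smul_zero]

theorem hValue_coe (μ : Module.Dual ℂ H) (h : H) :
    B.hValue μ (1 ⊗ₜ[ℂ] (h : L)) = MvPolynomial.C (μ h) := by
  have hsum : h = ∑ i : b.support, B.basis.repr (h : L) (Sum.inr (Sum.inl i)) •
      (rootSystem H).coroot i := by
    apply Subtype.val_injective
    have := B.basis.sum_repr (h : L)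
    rw [Fintype.sum_sum_type, Fintype.sum_sum_type,
      Finset.sum_eq_zero (s := (Finset.univ : Finset (PosRoot b))) (fun α _ => by
        rw [B.repr_coe h (ht_inl_neg α).ne, zero_smul]), zero_add,
      Finset.sum_eq_zero (s := (Finset.univ : Finset (PosRoot b))) (fun α _ => by
        rw [B.repr_coe h (ht_inr_inr_pos α).ne', zero_smul]), add_zero] at this
    refine this.symm.trans ?_
    refine Eq.trans ?_ (map_sum H.toSubmodule.subtype _ _).symm
    refine Finset.sum_congr rfl fun i _ => ?_
    rw [B.h_eq]
    rfl
  conv_rhs => rw [hsum, map_sum, map_sum]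
  rw [hValue, LinearMap.sum_apply]
  refine Finset.sum_congr rfl fun i _ => ?_
  rw [LinearMap.smul_apply, Module.Basis.coord_apply, polyBasis_repr_tmul, map_smul, smul_eq_mul,
    smul_eq_mul, map_mul, mul_comm, MvPolynomial.smul_eq_C_mul, mul_one]

end RootBasis

end Roots

/-! ### The operators attached to elements of `ℂ[x] ⊗ L` -/

section Roots

variable {L : Type*} [LieRing L] [LieAlgebra ℂ L] [FiniteDimensional ℂ L] [LieAlgebra.IsSimple ℂ L]
  {H : LieSubalgebra ℂ L} [H.IsCartanSubalgebra] {b : (rootSystem H).Base}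

namespace RootBasis

variable (B : RootBasis b)

/-- The differential operator `-∑_α [todd(ad w) y_{n̄}]_α ∂_α + μ(y_H)`. -/
def polyOp (w : MvPolynomial (PosRoot b) ℂ ⊗[ℂ] L) (μ : Module.Dual ℂ H)
    (y : MvPolynomial (PosRoot b) ℂ ⊗[ℂ] L) : WeylAlgebra (PosRoot b) :=
  -(∑ α : PosRoot b, WeylAlgebra.ofPoly
      (B.fCoord α (evalNilpotent toddSeries (adPoly w) (B.nbarPart y))) * WeylAlgebra.d α)
    + WeylAlgebra.ofPoly (B.hValue μ y)

theorem diffOp_eq_polyOp (w : MvPolynomial (PosRoot b) ℂ ⊗[ℂ] L) (μ : Module.Dual ℂ H) (a : L) :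
    B.diffOp w μ a =
      B.polyOp w μ (evalNilpotent (PowerSeries.exp ℂ) (-adPoly w) (1 ⊗ₜ[ℂ] a)) := rfl

variable (w : MvPolynomial (PosRoot b) ℂ ⊗[ℂ] L) (μ : Module.Dual ℂ H)

theorem polyOp_add (y z : MvPolynomial (PosRoot b) ℂ ⊗[ℂ] L) :
    B.polyOp w μ (y + z) = B.polyOp w μ y + B.polyOp w μ z := by
  simp only [polyOp, map_add, add_mul, Finset.sum_add_distrib]
  abel

/-- Polynomials stand to the left of the derivatives, so powers of `x_θ` produced by `e^{-x_θ ad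
f_θ}` can be pulled out. -/
theorem polyOp_smul (p : MvPolynomial (PosRoot b) ℂ) (y : MvPolynomial (PosRoot b) ℂ ⊗[ℂ] L) :
    B.polyOp w μ (p • y) = WeylAlgebra.ofPoly p * B.polyOp w μ y := by
  simp only [polyOp, map_smul, smul_eq_mul, map_mul, mul_add, WeylAlgebra.mul_neg_eq, Finset.mul_sum, mul_assoc]

theorem polyOp_tmul_f {w : MvPolynomial (PosRoot b) ℂ ⊗[ℂ] L} (hw : IsNilpotent (adPoly w))
    {α : PosRoot b} (h : adPoly w (1 ⊗ₜ[ℂ] B.f α) = 0) :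
    B.polyOp w μ (1 ⊗ₜ[ℂ] B.f α) = -WeylAlgebra.d α := by
  classical
  have hmem := B.tmul_f_mem_nbar 1 α
  rw [polyOp, B.hValue_of_mem_nbar μ hmem, map_zero, add_zero, B.nbarPart_of_mem_nbar hmem,
    evalNilpotent_apply_of_apply_eq_zero hw h, constantCoeff_toddSeries, map_one, one_smul,
    Finset.sum_eq_single_of_mem α (Finset.mem_univ _)]
  · rw [fCoord_apply, polyBasis_repr_tmul, f, B.basis.repr_self, Finsupp.single_eq_same, one_smul,
      map_one, one_mul]
  · intro β _ hβ
    rw [fCoord_apply, polyBasis_repr_tmul, f, B.basis.repr_self,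
      Finsupp.single_eq_of_ne (by simpa using hβ), zero_smul, map_zero, zero_mul]

theorem diffOp_f {w : MvPolynomial (PosRoot b) ℂ ⊗[ℂ] L} (hw : IsNilpotent (adPoly w))
    {α : PosRoot b} (h : adPoly w (1 ⊗ₜ[ℂ] B.f α) = 0) :
    B.diffOp w μ (B.f α) = -WeylAlgebra.d α := by
  rw [diffOp_eq_polyOp, evalNilpotent_apply_of_apply_eq_zero (isNilpotent_neg_end hw)
    (by rw [LinearMap.neg_apply, h, neg_zero]), PowerSeries.constantCoeff_exp, map_one, one_smul,
    B.polyOp_tmul_f μ hw h]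

theorem diffOp_add (a c : L) : B.diffOp w μ (a + c) = B.diffOp w μ a + B.diffOp w μ c := by
  rw [diffOp_eq_polyOp, TensorProduct.tmul_add, map_add, polyOp_add]
  rfl

theorem diffOp_smul (r : ℂ) (a : L) : B.diffOp w μ (r • a) = r • B.diffOp w μ a := by
  have h : (1 : MvPolynomial (PosRoot b) ℂ) ⊗ₜ[ℂ] (r • a) =
      (algebraMap ℂ (MvPolynomial (PosRoot b) ℂ) r) • ((1 : MvPolynomial (PosRoot b) ℂ) ⊗ₜ[ℂ] a) := by
    rw [TensorProduct.tmul_smul, algebraMap_smul]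
  rw [diffOp_eq_polyOp, h, map_smul, polyOp_smul, AlgHom.commutes, ← Algebra.smul_def]
  rfl

/-- The map `diffOp w μ` as a linear map. -/
def diffOpLin : L →ₗ[ℂ] WeylAlgebra (PosRoot b) where
  toFun := B.diffOp w μ
  map_add' := B.diffOp_add w μ
  map_smul' := B.diffOp_smul w μ

variable (S : Finset (PosRoot b))

theorem lie_f_coe (α : PosRoot b) (h : H) : ⁅B.f α, (h : L)⁆ = α.form h • B.f α := by
  have := B.lie_basis h (Sum.inl α)
  rw [← lie_skew, f, this]
  simp [wt]

theorem adPoly_uSum_coe (h : H) :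
    adPoly (B.uSum S) (1 ⊗ₜ[ℂ] (h : L)) =
      ∑ α ∈ S, (α.form h • MvPolynomial.X α) ⊗ₜ[ℂ] B.f α := by
  rw [adPoly_uSum_tmul]
  refine Finset.sum_congr rfl fun α _ => ?_
  rw [lie_f_coe, mul_one, TensorProduct.tmul_smul, TensorProduct.smul_tmul']

theorem adPoly_uSum_coe_mem_nbar (h : H) :
    adPoly (B.uSum S) (1 ⊗ₜ[ℂ] (h : L)) ∈ B.nbar := by
  rw [adPoly_uSum_coe]
  exact Submodule.sum_mem _ fun α _ => B.tmul_f_mem_nbar _ α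

/-- `ad w` maps `h` into `ℂ[x] ⊗ n̄` and preserves this submodule, so only the constant term of the
exponential contributes outside it. -/
theorem exp_coe_sub_mem_nbar (h : H) :
    evalNilpotent (PowerSeries.exp ℂ) (-adPoly (B.uSum S)) (1 ⊗ₜ[ℂ] (h : L)) -
      1 ⊗ₜ[ℂ] (h : L) ∈ B.nbar := by
  have := evalNilpotent_apply_sub_mem (PowerSeries.exp ℂ) (N := B.nbar) (m := 1 ⊗ₜ[ℂ] (h : L))
    (isNilpotent_neg_end (B.isNilpotent_adPoly_uSum S))
    (fun m hm => by
      rw [LinearMap.neg_apply]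
      exact neg_mem (B.adPoly_uSum_mem_nbar S hm))
    (by
      rw [LinearMap.neg_apply]
      exact neg_mem (B.adPoly_uSum_coe_mem_nbar S h))
  rwa [PowerSeries.constantCoeff_exp, map_one, one_smul] at this

theorem hValue_exp_coe (h : H) :
    B.hValue μ (evalNilpotent (PowerSeries.exp ℂ) (-adPoly (B.uSum S)) (1 ⊗ₜ[ℂ] (h : L))) =
      MvPolynomial.C (μ h) := by
  rw [← B.hValue_coe, ← sub_eq_zero, ← map_sub]
  exact B.hValue_of_mem_nbar μ (B.exp_coe_sub_mem_nbar S h)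

open scoped Classical in
/-- The operator attached to an element of the Cartan subalgebra. -/
theorem diffOp_uSum_coe (h : H) :
    B.diffOp (B.uSum S) μ (h : L) =
      WeylAlgebra.euler (fun α : PosRoot b => if α ∈ S then α.form h else 0) +
        algebraMap ℂ _ (μ h) := by
  have hy := B.exp_coe_sub_mem_nbar S h
  rw [diffOp, hValue_exp_coe]
  congr 1
  -- The `n̄`-part is `(e^{-ad w} - 1) h`, which the Todd operator turns into `-ad(w) h = -∑ α(h)
  -- x_α f_α`.
  · rw [← sub_add_cancel (evalNilpotent (PowerSeries.exp ℂ) (-adPoly (B.uSum S)) (1 ⊗ₜ[ℂ] (h : L)))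
      (1 ⊗ₜ[ℂ] (h : L)), map_add, nbarPart_coe, add_zero, B.nbarPart_of_mem_nbar hy,
      evalNilpotent_toddSeries_exp_sub (B.isNilpotent_adPoly_uSum S), WeylAlgebra.euler,
      adPoly_uSum_coe, ← Finset.sum_neg_distrib]
    refine Finset.sum_congr rfl fun α _ => ?_
    rw [map_neg, map_neg, WeylAlgebra.neg_mul_eq, neg_neg, map_sum]
    have : ∀ β ∈ S, B.fCoord α ((β.form h • MvPolynomial.X β) ⊗ₜ[ℂ] B.f β) =
        if β = α then α.form h • MvPolynomial.X α else 0 := by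
      intro β _
      rw [fCoord_apply, polyBasis_repr_tmul, f, B.basis.repr_self, Finsupp.single_apply]
      simp only [Sum.inl.injEq]
      split_ifs with hβ
      · rw [one_smul, hβ]
      · rw [zero_smul]
    rw [Finset.sum_congr rfl this, Finset.sum_ite_eq' S α]
    split_ifs
    · rw [map_smul, WeylAlgebra.ofPoly_X, smul_mul_assoc]
    · rw [map_zero, zero_mul, zero_smul]
  · exact AlgHom.commutes _ _

/-! ### Homogeneity -/

variable (E : Derivation ℂ (MvPolynomial (PosRoot b) ℂ) (MvPolynomial (PosRoot b) ℂ)) (h : H)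

/-- The endomorphism `E ⊗ 1 + 1 ⊗ ad h` of `ℂ[x] ⊗ L`. -/
def tensorDer : Module.End ℂ (MvPolynomial (PosRoot b) ℂ ⊗[ℂ] L) :=
  (E : MvPolynomial (PosRoot b) ℂ →ₗ[ℂ] MvPolynomial (PosRoot b) ℂ).rTensor L +
    (LieAlgebra.ad ℂ L (h : L)).lTensor (MvPolynomial (PosRoot b) ℂ)

variable {E h}

theorem tensorDer_tmul (p : MvPolynomial (PosRoot b) ℂ) (y : L) :
    tensorDer E h (p ⊗ₜ[ℂ] y) = E p ⊗ₜ[ℂ] y + p ⊗ₜ[ℂ] ⁅(h : L), y⁆ := rfl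

theorem adPoly_tmul_tmul (p q : MvPolynomial (PosRoot b) ℂ) (y z : L) :
    adPoly (p ⊗ₜ[ℂ] y) (q ⊗ₜ[ℂ] z) = (p * q) ⊗ₜ[ℂ] ⁅y, z⁆ := rfl

theorem adPoly_add (y z : MvPolynomial (PosRoot b) ℂ ⊗[ℂ] L) :
    adPoly (y + z) = adPoly y + adPoly z :=
  map_add (LieAlgebra.ad (MvPolynomial (PosRoot b) ℂ) (MvPolynomial (PosRoot b) ℂ ⊗[ℂ] L)) y z

theorem adPoly_zero : adPoly (0 : MvPolynomial (PosRoot b) ℂ ⊗[ℂ] L) = 0 :=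
  map_zero (LieAlgebra.ad (MvPolynomial (PosRoot b) ℂ) (MvPolynomial (PosRoot b) ℂ ⊗[ℂ] L))

theorem tensorDer_adPoly (y z : MvPolynomial (PosRoot b) ℂ ⊗[ℂ] L) :
    tensorDer E h (adPoly y z) = adPoly (tensorDer E h y) z + adPoly y (tensorDer E h z) := by
  induction y using TensorProduct.induction_on with
  | zero => simp [adPoly_zero]
  | add y y' hy hy' => simp only [adPoly_add, LinearMap.add_apply, map_add, hy, hy']; abel
  | tmul p y =>
    induction z using TensorProduct.induction_on with
    | zero => simp
    | add z z' hz hz' => simp only [map_add, hz, hz']; abel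
    | tmul q z =>
      simp only [adPoly_tmul_tmul, tensorDer_tmul, Derivation.leibniz, adPoly_add,
        LinearMap.add_apply, map_add, smul_eq_mul, TensorProduct.add_tmul, leibniz_lie (h : L),
        TensorProduct.tmul_add, mul_comm q]
      abel

theorem repr_tensorDer (y : MvPolynomial (PosRoot b) ℂ ⊗[ℂ] L)
    (k : PosRoot b ⊕ b.support ⊕ PosRoot b) :
    B.polyBasis.repr (tensorDer E h y) k =
      E (B.polyBasis.repr y k) + wt k h • B.polyBasis.repr y k := by
  induction y using TensorProduct.induction_on with
  | zero => simp
  | add y z hy hz =>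
    simp only [map_add, Finsupp.add_apply, hy, hz, smul_add]
    abel
  | tmul p y =>
    rw [tensorDer_tmul, map_add, Finsupp.add_apply, polyBasis_repr_tmul, polyBasis_repr_tmul,
      polyBasis_repr_tmul, B.repr_lie, Derivation.map_smul, smul_smul]

theorem tensorDer_nbarPart (y : MvPolynomial (PosRoot b) ℂ ⊗[ℂ] L) :
    tensorDer E h (B.nbarPart y) = B.nbarPart (tensorDer E h y) := by
  refine B.polyBasis.repr.injective (Finsupp.ext fun k => ?_)
  rw [repr_tensorDer]
  rcases k with α | k
  · rw [repr_nbarPart_inl, repr_nbarPart_inl, repr_tensorDer]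
  · rw [B.mem_nbar.1 (B.nbarPart_mem_nbar _), B.mem_nbar.1 (B.nbarPart_mem_nbar _), map_zero,
      smul_zero, add_zero]

variable {S}

/-- The weight `α(h)` of the variable cancels the weight `-α(h)` of `f_α`. As a result `tensorDer`
commutes with every power series in `ad w`. -/
theorem tensorDer_uSum (hE : ∀ α ∈ S, E (MvPolynomial.X α) = α.form h • MvPolynomial.X α) :
    tensorDer E h (B.uSum S) = 0 := by
  rw [uSum, map_sum]
  refine Finset.sum_eq_zero fun α hα => ?_
  rw [tensorDer_tmul, hE α hα, ← lie_skew, lie_f_coe, TensorProduct.tmul_neg,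
    TensorProduct.tmul_smul, TensorProduct.smul_tmul', add_neg_cancel]

theorem tensorDer_evalNilpotent {w : MvPolynomial (PosRoot b) ℂ ⊗[ℂ] L}
    (hw : tensorDer E h w = 0) (φ : PowerSeries ℂ)
    {T : Module.End (MvPolynomial (PosRoot b) ℂ) (MvPolynomial (PosRoot b) ℂ ⊗[ℂ] L)}
    (hT : IsNilpotent T) (hTw : T = adPoly w ∨ T = -adPoly w)
    (y : MvPolynomial (PosRoot b) ℂ ⊗[ℂ] L) :
    tensorDer E h (evalNilpotent φ T y) = evalNilpotent φ T (tensorDer E h y) := by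
  have had : ∀ y, tensorDer E h (adPoly w y) = adPoly w (tensorDer E h y) := fun y => by
    rw [tensorDer_adPoly, hw, adPoly_zero, LinearMap.zero_apply, zero_add]
  refine map_evalNilpotent_apply φ hT (tensorDer E h).toAddMonoidHom (fun y => ?_)
    (fun r y => ?_) y
  · rcases hTw with rfl | rfl
    · exact had y
    · simpa using had y
  · rw [algebraMap_smul, algebraMap_smul]
    exact map_smul (tensorDer E h) r y

/-- The coefficients of `diffOp` are homogeneous. -/
theorem exists_diffOp_eq (hE : ∀ α ∈ S, E (MvPolynomial.X α) = α.form h • MvPolynomial.X α)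
    {a : L} {κ : ℂ} (ha : ⁅(h : L), a⁆ = κ • a) :
    ∃ (p : PosRoot b → MvPolynomial (PosRoot b) ℂ) (q : MvPolynomial (PosRoot b) ℂ),
      B.diffOp (B.uSum S) μ a =
        -∑ α, WeylAlgebra.ofPoly (p α) * WeylAlgebra.d α + WeylAlgebra.ofPoly q ∧
      (∀ α, E (p α) = (κ + α.form h) • p α) ∧ E q = κ • q := by
  have hw := B.tensorDer_uSum hE
  have hn := B.isNilpotent_adPoly_uSum S
  set z := evalNilpotent (PowerSeries.exp ℂ) (-adPoly (B.uSum S)) (1 ⊗ₜ[ℂ] a) with hz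
  have hz' : tensorDer E h z = κ • z := by
    rw [hz, tensorDer_evalNilpotent hw _ (isNilpotent_neg_end hn) (Or.inr rfl), tensorDer_tmul, ha,
      Derivation.map_one_eq_zero, TensorProduct.zero_tmul, zero_add, TensorProduct.tmul_smul,
      ← algebraMap_smul (MvPolynomial (PosRoot b) ℂ) κ, map_smul, algebraMap_smul]
  refine ⟨fun α => B.fCoord α (evalNilpotent toddSeries (adPoly (B.uSum S)) (B.nbarPart z)),
    B.hValue μ z, rfl, fun α => ?_, ?_⟩
  · have h₁ : tensorDer E h (evalNilpotent toddSeries (adPoly (B.uSum S)) (B.nbarPart z)) =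
        κ • evalNilpotent toddSeries (adPoly (B.uSum S)) (B.nbarPart z) := by
      rw [tensorDer_evalNilpotent hw _ hn (Or.inl rfl), tensorDer_nbarPart, hz',
        ← algebraMap_smul (MvPolynomial (PosRoot b) ℂ) κ, map_smul, map_smul, algebraMap_smul]
    have h₂ := B.repr_tensorDer (E := E) (h := h)
      (evalNilpotent toddSeries (adPoly (B.uSum S)) (B.nbarPart z)) (Sum.inl α)
    rw [h₁, ← algebraMap_smul (MvPolynomial (PosRoot b) ℂ) κ, map_smul, Finsupp.smul_apply,
      algebraMap_smul] at h₂
    -- The whole vector has weight `κ` and `f_α` has weight `-α(h)`, so its coefficient has weight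
    -- `κ + α(h)`.
    change E (B.polyBasis.repr _ (Sum.inl α)) = (κ + α.form h) • B.polyBasis.repr _ (Sum.inl α)
    rw [add_smul, h₂]
    simp [wt]
  · have h₁ : ∀ k : b.support, E (B.polyBasis.repr z (Sum.inr (Sum.inl k))) =
        κ • B.polyBasis.repr z (Sum.inr (Sum.inl k)) := by
      intro k
      have h₂ := B.repr_tensorDer (E := E) (h := h) z (Sum.inr (Sum.inl k))
      rw [hz', ← algebraMap_smul (MvPolynomial (PosRoot b) ℂ) κ, map_smul, Finsupp.smul_apply,
        algebraMap_smul] at h₂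
      rw [h₂]
      simp [wt]
    rw [hValue, LinearMap.sum_apply, map_sum, Finset.smul_sum]
    refine Finset.sum_congr rfl fun k _ => ?_
    rw [LinearMap.smul_apply, Module.Basis.coord_apply, smul_eq_mul, ← MvPolynomial.smul_eq_C_mul,
      Derivation.map_smul, h₁, smul_comm]

end RootBasis

end Roots

/-! ### The `sl₂`-triple in the Weyl algebra -/

section Abstract

variable {A : Type*} [Ring A] [Algebra ℂ A] {s e x d : A}

/-- Used with `s = σ(h_θ)`, `e = σ(e_θ)`, `x = x_θ`, `d = ∂_θ`. The weight of `e` is measured by the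
full operator `s + 2 x d`. -/
theorem sl2_lie_h_e (hsx : s * x = x * s) (hsd : s * d = d * s)
    (hdx : d * x = x * d + 1)
    (hh : (s + (2 : ℂ) • (x * d)) * e = e * (s + (2 : ℂ) • (x * d)) + (2 : ℂ) • e) :
    (s + (2 : ℂ) • (x * d)) * (e + x * s + x * x * d) -
      (e + x * s + x * x * d) * (s + (2 : ℂ) • (x * d)) =
        (2 : ℂ) • (e + x * s + x * x * d) := by
  have hdx' : ∀ z, d * (x * z) = x * (d * z) + z := fun z => by
    rw [← mul_assoc, hdx, add_mul, one_mul, mul_assoc]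
  have hsx' : ∀ z, s * (x * z) = x * (s * z) := fun z => by rw [← mul_assoc, hsx, mul_assoc]
  rw [add_assoc e, mul_add, hh, add_mul e]
  simp only [mul_add, add_mul, mul_assoc, hdx', hsx', hsd, smul_mul_assoc, mul_smul_comm, smul_add]
  module

theorem sl2_lie_h_f (hsd : s * d = d * s) (hdx : d * x = x * d + 1) :
    (s + (2 : ℂ) • (x * d)) * -d - -d * (s + (2 : ℂ) • (x * d)) = -((2 : ℂ) • -d) := by
  have hdx' : ∀ z, d * (x * z) = x * (d * z) + z := fun z => by
    rw [← mul_assoc, hdx, add_mul, one_mul, mul_assoc]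
  simp only [mul_add, add_mul, mul_assoc, hdx', hsd, smul_mul_assoc, mul_neg, neg_mul,
    mul_smul_comm]
  module

theorem sl2_lie_e_f (hsd : s * d = d * s) (hdx : d * x = x * d + 1) (hde : d * e = e * d) :
    (e + x * s + x * x * d) * -d - -d * (e + x * s + x * x * d) = s + (2 : ℂ) • (x * d) := by
  have hdx' : ∀ z, d * (x * z) = x * (d * z) + z := fun z => by
    rw [← mul_assoc, hdx, add_mul, one_mul, mul_assoc]
  simp only [mul_add, add_mul, mul_assoc, hdx', hsd, hde, mul_neg, neg_mul]
  module

/-- The first three summands multiply out to terms in which `±2 x s d`, `±2 x² d²` and `±2 x d`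
cancel, leaving `½ s² - s - 2 e d`. -/
theorem sl2_casimir (hsx : s * x = x * s) (hsd : s * d = d * s) (hdx : d * x = x * d + 1)
    (hde : d * e = e * d) :
    (e + x * s + x * x * d) * -d + -d * (e + x * s + x * x * d) +
        (1 / 2 : ℂ) • (s + (2 : ℂ) • (x * d)) ^ 2 =
      (1 / 2 : ℂ) • (s * (s - 2)) + 2 * (e * -d) := by
  have hdx' : ∀ z, d * (x * z) = x * (d * z) + z := fun z => by
    rw [← mul_assoc, hdx, add_mul, one_mul, mul_assoc]
  have hsx' : ∀ z, s * (x * z) = x * (s * z) := fun z => by rw [← mul_assoc, hsx, mul_assoc]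
  simp only [pow_two, mul_add, add_mul, mul_assoc, hdx', hsx', hsd, hde, mul_neg, neg_mul,
    smul_mul_assoc, mul_smul_comm, smul_add, mul_sub, mul_two, two_mul]
  module

variable {L : Type*} [LieRing L] [LieAlgebra ℂ L]

/-- A linear map that respects the relations of an `sl₂`-triple respects the brackets on its span. -/
theorem IsSl2Triple.map_lie {h e f : L} (T : IsSl2Triple h e f) (φ : L →ₗ[ℂ] A)
    (h₁ : φ h * φ e - φ e * φ h = (2 : ℂ) • φ e) (h₂ : φ h * φ f - φ f * φ h = -((2 : ℂ) • φ f))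
    (h₃ : φ e * φ f - φ f * φ e = φ h) {y z : L} (hy : y ∈ T.toLieSubalgebra ℂ)
    (hz : z ∈ T.toLieSubalgebra ℂ) : φ ⁅y, z⁆ = φ y * φ z - φ z * φ y := by
  obtain ⟨a₁, a₂, a₃, rfl⟩ := IsSl2Triple.mem_toLieSubalgebra_iff.1 hy
  obtain ⟨c₁, c₂, c₃, rfl⟩ := IsSl2Triple.mem_toLieSubalgebra_iff.1 hz
  have hfe : ⁅f, e⁆ = -h := by rw [← lie_skew, T.lie_e_f]
  have heh : ⁅e, h⁆ = -((2 : ℂ) • e) := by rw [← lie_skew, T.lie_h_e_smul ℂ]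
  have hfh : ⁅f, h⁆ = (2 : ℂ) • f := by rw [← lie_skew, T.lie_lie_smul_f ℂ, neg_neg]
  have h₁' : φ h * φ e = φ e * φ h + (2 : ℂ) • φ e := by rw [← h₁]; abel
  have h₂' : φ h * φ f = φ f * φ h - (2 : ℂ) • φ f := by rw [sub_eq_add_neg, ← h₂]; abel
  have h₃' : φ e * φ f = φ f * φ e + φ h := by rw [← h₃]; abel
  simp only [T.lie_e_f, lie_add, add_lie, lie_smul, smul_lie, lie_self, hfe, heh, hfh,
    T.lie_h_e_smul ℂ, T.lie_lie_smul_f ℂ, map_add, map_smul, map_neg, mul_add, add_mul,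
    smul_mul_assoc, mul_smul_comm, h₁', h₂', h₃', map_zero]
  module

/-- A linear map that respects the relations of an `sl₂`-triple extends to the enveloping algebra of
its span. -/
theorem IsSl2Triple.exists_algHom {h e f : L} (T : IsSl2Triple h e f) (φ : L →ₗ[ℂ] A)
    (h₁ : φ h * φ e - φ e * φ h = (2 : ℂ) • φ e) (h₂ : φ h * φ f - φ f * φ h = -((2 : ℂ) • φ f))
    (h₃ : φ e * φ f - φ f * φ e = φ h) :
    ∃ Φ : UniversalEnvelopingAlgebra ℂ (T.toLieSubalgebra ℂ) →ₐ[ℂ] A,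
      (∀ y : T.toLieSubalgebra ℂ, Φ (UniversalEnvelopingAlgebra.ι ℂ y) = φ y) ∧
      Φ (casimirElement T) = φ e * φ f + φ f * φ e + (1 / 2 : ℂ) • φ h ^ 2 := by
  let _ : LieRing A := LieRing.ofAssociativeRing
  let ψ : T.toLieSubalgebra ℂ →ₗ⁅ℂ⁆ A :=
    { φ.comp (T.toLieSubalgebra ℂ).toSubmodule.subtype with
      map_lie' := fun {y z} => by
        rw [LieRing.of_associative_ring_bracket]
        exact T.map_lie φ h₁ h₂ h₃ y.2 z.2 }
  have h : ∀ y : T.toLieSubalgebra ℂ, UniversalEnvelopingAlgebra.lift ℂ ψ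
      (UniversalEnvelopingAlgebra.ι ℂ y) = φ y := fun y =>
    UniversalEnvelopingAlgebra.lift_ι_apply ..
  refine ⟨UniversalEnvelopingAlgebra.lift ℂ ψ, h, ?_⟩
  simp only [casimirElement, map_add, map_mul, map_smul, map_pow, h]

end Abstract

/-! ### Maximality of `θ` and the splitting of `u` -/

section Roots

variable {L : Type*} [LieRing L] [LieAlgebra ℂ L] [FiniteDimensional ℂ L] [LieAlgebra.IsSimple ℂ L]
  {H : LieSubalgebra ℂ L} [H.IsCartanSubalgebra] {b : (rootSystem H).Base}

/-- The weight `-(α + β)` occurs in `L`, and it is nonzero because it is negative on the height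
element; so it is a root, and so is its negative. -/
theorem form_add_form_mem_range {α β : PosRoot b} {y : L} (hy₀ : y ≠ 0)
    (hy : y ∈ rootSpace H (-(α.form : H → ℂ) + -(β.form : H → ℂ))) :
    β.form + α.form ∈ Set.range (rootSystem H).root := by
  obtain ⟨ρ, hρ⟩ := exists_height_element b
  have hne : rootSpace H (-(α.form : H → ℂ) + -(β.form : H → ℂ)) ≠ ⊥ := by
    intro h
    rw [h] at hy
    exact hy₀ ((LieSubmodule.mem_bot y).1 hy)
  let W : LieModule.Weight ℂ H L := ⟨_, hne⟩
  have hW : W.IsNonZero := by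
    intro h
    have h₁ : (W : H → ℂ) ρ = 0 := by rw [h]; rfl
    have h₂ : (W : H → ℂ) ρ = -(b.height α.1 : ℂ) + -(b.height β.1 : ℂ) := by
      rw [← hρ, ← hρ]; rfl
    have h₃ : 0 < b.height α.1 := α.2
    have h₄ : 0 < b.height β.1 := β.2
    rw [h₁] at h₂
    have : (0 : ℤ) = -b.height α.1 + -b.height β.1 := by exact_mod_cast h₂
    omega
  rw [← RootPairing.neg_mem_range_root_iff]
  refine ⟨⟨W, by simpa using hW⟩, LinearMap.ext fun h => ?_⟩
  change -(α.form h) + -(β.form h) = -(β.form h + α.form h)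
  ring

namespace RootBasis

variable (B : RootBasis b)

theorem lie_f_f_of_isMaximalRoot {θ : PosRoot b} (hθ : IsMaximalRoot θ) (α : PosRoot b) :
    ⁅B.f α, B.f θ⁆ = 0 := by
  by_contra hne
  exact hθ α (form_add_form_mem_range hne
    (lie_mem_genWeightSpace_of_mem_genWeightSpace (B.f_mem α) (B.f_mem θ)))

theorem u_eq : B.u = B.uSum Finset.univ := rfl

open scoped Classical in
theorem v_eq (θ : PosRoot b) : B.v θ = B.uSum (Finset.univ.erase θ) := rfl

open scoped Classical in
theorem u_eq_add (θ : PosRoot b) : B.u = B.v θ + B.uSum {θ} :=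
  (Finset.sum_erase_add _ _ (Finset.mem_univ θ)).symm.trans
    (congrArg _ (Finset.sum_singleton _ _).symm)

section Maximal

variable {θ : PosRoot b} (hθ : IsMaximalRoot θ) (S : Finset (PosRoot b)) (μ : Module.Dual ℂ H)

include hθ

theorem adPoly_uSum_f (p : MvPolynomial (PosRoot b) ℂ) :
    adPoly (B.uSum S) (p ⊗ₜ[ℂ] B.f θ) = 0 := by
  rw [adPoly_uSum_tmul]
  refine Finset.sum_eq_zero fun α _ => ?_
  rw [B.lie_f_f_of_isMaximalRoot hθ, TensorProduct.tmul_zero]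

theorem adPoly_uSum_singleton_of_mem_nbar {y : MvPolynomial (PosRoot b) ℂ ⊗[ℂ] L}
    (hy : y ∈ B.nbar) : adPoly (B.uSum {θ}) y = 0 := by
  rw [B.eq_sum_of_mem_nbar hy, map_sum]
  refine Finset.sum_eq_zero fun α _ => ?_
  rw [map_smul, adPoly_uSum_tmul, Finset.sum_singleton, ← lie_skew,
    B.lie_f_f_of_isMaximalRoot hθ, neg_zero, TensorProduct.tmul_zero, smul_zero]

/-- By the Jacobi identity the commutator is the adjoint action of a bracket with `x_θ f_θ`, which
vanishes because `f_θ` is central in `n̄`. -/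
theorem commute_adPoly_uSum : Commute (adPoly (B.uSum S)) (adPoly (B.uSum {θ})) := by
  have h : adPoly (B.uSum S) (B.uSum {θ}) = 0 := by
    conv_lhs => rw [uSum.eq_1 B {θ}]
    rw [Finset.sum_singleton, B.adPoly_uSum_f hθ]
  refine LinearMap.ext fun y => ?_
  refine (LieRing.leibniz_lie (B.uSum S) (B.uSum {θ}) y).trans ?_
  rw [show ⁅B.uSum S, B.uSum {θ}⁆ = 0 from h]
  change adPoly 0 y + adPoly (B.uSum {θ}) (adPoly (B.uSum S) y) = _
  rw [adPoly_zero, LinearMap.zero_apply, zero_add]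
  rfl

/-- The Todd operator is applied to elements of `ℂ[x] ⊗ n̄` only, and there `ad(x_θ f_θ)` vanishes.
-/
theorem polyOp_u : B.polyOp B.u μ = B.polyOp (B.v θ) μ := by
  classical
  funext y
  have h : evalNilpotent toddSeries (adPoly B.u) (B.nbarPart y) =
      evalNilpotent toddSeries (adPoly (B.v θ)) (B.nbarPart y) := by
    refine evalNilpotent_apply_congr toddSeries (B.isNilpotent_adPoly_uSum _)
      (B.isNilpotent_adPoly_uSum _) (N := B.nbar) (fun m hm => B.adPoly_uSum_mem_nbar _ hm)
      (fun m hm => ?_) (B.nbarPart_mem_nbar y)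
    change adPoly B.u m = adPoly (B.v θ) m
    rw [B.u_eq_add θ, adPoly_add, LinearMap.add_apply,
      B.adPoly_uSum_singleton_of_mem_nbar hθ hm, add_zero]
  rw [polyOp, polyOp, h]

theorem diffOp_u_e (T : IsSl2Triple (θ.coroot : L) (B.e θ) (B.f θ)) :
    B.diffOp B.u μ (B.e θ) = B.diffOp (B.v θ) μ (B.e θ) +
      WeylAlgebra.x θ * B.diffOp (B.v θ) μ (θ.coroot : L) +
      WeylAlgebra.x θ * WeylAlgebra.x θ * WeylAlgebra.d θ := by
  classical
  set X : MvPolynomial (PosRoot b) ℂ := MvPolynomial.X θ with hX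
  have hv : IsNilpotent (adPoly (B.v θ)) := B.isNilpotent_adPoly_uSum (Finset.univ.erase θ)
  have hs := B.isNilpotent_adPoly_uSum {θ}
  have hcomm : Commute (adPoly (B.v θ)) (adPoly (B.uSum {θ})) :=
    B.commute_adPoly_uSum hθ (Finset.univ.erase θ)
  have hvf : ∀ p, adPoly (B.v θ) (p ⊗ₜ[ℂ] B.f θ) = 0 := fun p => B.adPoly_uSum_f hθ _ p
  have hs₀ : ∀ p y, (-adPoly (B.uSum {θ})) (p ⊗ₜ[ℂ] y) = (X * p) ⊗ₜ[ℂ] ⁅y, B.f θ⁆ := by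
    intro p y
    rw [LinearMap.neg_apply, adPoly_uSum_tmul, Finset.sum_singleton, ← TensorProduct.tmul_neg,
      lie_skew]
  have h₁ : (-adPoly (B.uSum {θ})) (1 ⊗ₜ[ℂ] B.e θ) = X ⊗ₜ[ℂ] (θ.coroot : L) := by
    rw [hs₀, T.lie_e_f, mul_one]
  have h₂ : (-adPoly (B.uSum {θ})) (X ⊗ₜ[ℂ] (θ.coroot : L)) =
      -((2 : MvPolynomial (PosRoot b) ℂ) • ((X * X) ⊗ₜ[ℂ] B.f θ)) := by
    rw [← map_ofNat (algebraMap ℂ (MvPolynomial (PosRoot b) ℂ)) 2, algebraMap_smul, hs₀, T.lie_lie_smul_f ℂ, TensorProduct.tmul_neg, TensorProduct.tmul_smul]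
  have h₃ : (-adPoly (B.uSum {θ})) ((X * X) ⊗ₜ[ℂ] B.f θ) = 0 := by
    rw [hs₀, lie_self, TensorProduct.tmul_zero]
  -- The exponential stops at second order because `[f_θ, f_θ] = 0`; the coefficient `-x_θ²` is `½ ·
  -- (-2 x_θ²)`.
  have hexp : evalNilpotent (PowerSeries.exp ℂ) (-adPoly (B.uSum {θ})) (1 ⊗ₜ[ℂ] B.e θ) =
      1 ⊗ₜ[ℂ] B.e θ + X • (1 ⊗ₜ[ℂ] (θ.coroot : L)) + -(X * X) • (1 ⊗ₜ[ℂ] B.f θ) := by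
    have h₂' : ((-adPoly (B.uSum {θ})) ^ 2) (1 ⊗ₜ[ℂ] B.e θ) =
        -((2 : MvPolynomial (PosRoot b) ℂ) • ((X * X) ⊗ₜ[ℂ] B.f θ)) := by
      rw [pow_two, Module.End.mul_apply, h₁, h₂]
    rw [evalNilpotent_apply _ (isNilpotent_neg_end hs) (K := 3)
      (by
        rw [pow_succ', Module.End.mul_apply, h₂', map_neg, map_smul, h₃, smul_zero,
          neg_zero]),
      Finset.sum_range_succ, Finset.sum_range_succ, Finset.sum_range_one, h₂', pow_zero, pow_one,
      Module.End.one_apply, h₁]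
    have h₄ : X • (1 ⊗ₜ[ℂ] (θ.coroot : L)) = X ⊗ₜ[ℂ] (θ.coroot : L) := by
      rw [TensorProduct.smul_tmul', smul_eq_mul, mul_one]
    have h₅ : -(X * X) • (1 ⊗ₜ[ℂ] B.f θ) = -((X * X) ⊗ₜ[ℂ] B.f θ) := by
      rw [TensorProduct.smul_tmul', smul_eq_mul, mul_one, TensorProduct.neg_tmul]
    rw [h₄, h₅]
    rw [smul_neg, smul_smul, ← map_ofNat (algebraMap ℂ (MvPolynomial (PosRoot b) ℂ)) 2, ← map_mul]
    norm_num [PowerSeries.coeff_exp, Nat.factorial]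
  rw [diffOp_eq_polyOp, B.u_eq_add θ, adPoly_add, evalNilpotent_exp_neg_add hv hs hcomm, Module.End.mul_apply, hexp, map_add, map_add,
    map_smul, map_smul, polyOp_add, polyOp_add, polyOp_smul, polyOp_smul, ← B.u_eq_add θ, B.polyOp_u hθ,
    evalNilpotent_apply_of_apply_eq_zero (m := 1 ⊗ₜ[ℂ] B.f θ) (isNilpotent_neg_end hv)
      (by rw [LinearMap.neg_apply, neg_eq_zero]; exact hvf 1),
    PowerSeries.constantCoeff_exp, map_one, one_smul, B.polyOp_tmul_f μ hv (hvf 1), map_neg,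
    WeylAlgebra.neg_mul_eq, WeylAlgebra.mul_neg_eq, neg_neg, map_mul, hX, WeylAlgebra.ofPoly_X]
  rfl

end Maximal

end RootBasis

end Roots

/-! ### The representation and the Casimir element -/

/-- A commutation rule for elements of the form `-∑ i, P i * d i + Q`. -/
theorem mul_neg_sum_add_eq {A κ : Type*} [Ring A] [Algebra ℂ A] [Fintype κ] {D Q : A} {P d : κ → A}
    {r : κ → ℂ} {k : ℂ} (hP : ∀ i, D * P i = P i * D + (k + r i) • P i)
    (hd : ∀ i, D * d i = d i * D - r i • d i) (hQ : D * Q = Q * D + k • Q) :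
    D * (-∑ i, P i * d i + Q) = (-∑ i, P i * d i + Q) * D + k • (-∑ i, P i * d i + Q) := by
  have h : ∀ i, D * (P i * d i) = P i * d i * D + k • (P i * d i) := fun i => by
    rw [← mul_assoc, hP, add_mul, mul_assoc, hd, mul_sub, smul_mul_assoc, mul_smul_comm, mul_assoc]
    module
  rw [mul_add, mul_neg, Finset.mul_sum, hQ]
  simp only [h, Finset.sum_add_distrib, add_mul, neg_mul, Finset.sum_mul, smul_add, smul_neg,
    Finset.smul_sum]
  abel

theorem WeylAlgebra.op_add_algebraMap {ι : Type*} {j : ι} {p : WeylAlgebra ι} {w : GTModule j}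
    {k : ℂ} (h : op j p w = k • w) (r : ℂ) : op j (p + algebraMap ℂ _ r) w = (k + r) • w := by
  rw [map_add, LinearMap.add_apply, h, AlgHom.commutes, Module.algebraMap_end_apply]
  exact (add_smul (R := ℂ) (M := GTModule j) _ _ _).symm

section Roots

variable {L : Type*} [LieRing L] [LieAlgebra ℂ L] [FiniteDimensional ℂ L] [LieAlgebra.IsSimple ℂ L]
  {H : LieSubalgebra ℂ L} [H.IsCartanSubalgebra] {b : (rootSystem H).Base}

theorem PosRoot.form_coroot (α : PosRoot b) : α.form α.coroot = 2 :=
  (rootSystem H).root_coroot_two α.1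

namespace RootBasis

variable (B : RootBasis b) (θ : PosRoot b) (μ : Module.Dual ℂ H)

theorem d_mul_diffOp_v (a : L) :
    WeylAlgebra.d θ * B.diffOp (B.v θ) μ a = B.diffOp (B.v θ) μ a * WeylAlgebra.d θ := by
  classical
  -- Homogeneity for the derivation `∂_θ` and `h = 0`: all weights are 0, so every coefficient of
  -- σ(a) is killed by `∂_θ`.
  obtain ⟨p, q, h, hp, hq⟩ := B.exists_diffOp_eq (S := Finset.univ.erase θ) (h := 0)
    (E := MvPolynomial.pderiv θ) (κ := 0) (a := a) μ
    (fun α hα => by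
      rw [MvPolynomial.pderiv_X_of_ne (Finset.ne_of_mem_erase hα), map_zero, zero_smul])
    (by rw [ZeroMemClass.coe_zero, zero_lie, zero_smul])
  rw [B.v_eq θ, h]
  refine (mul_neg_sum_add_eq (r := fun _ => 0) (k := 0) (fun i => ?_) (fun i => ?_) ?_).trans ?_
  · rw [WeylAlgebra.d_mul_ofPoly, hp, map_zero, map_smul]
  · rw [WeylAlgebra.d_mul_d, zero_smul, sub_zero]
  · rw [WeylAlgebra.d_mul_ofPoly, hq, map_smul]
  · rw [zero_smul, add_zero]

theorem diffOp_u_coe (h : H) : B.diffOp B.u μ (h : L) =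
    WeylAlgebra.euler (fun α : PosRoot b => α.form h) + algebraMap ℂ _ (μ h) := by
  rw [B.u_eq, B.diffOp_uSum_coe]
  simp

open scoped Classical in
theorem diffOp_v_coe (h : H) : B.diffOp (B.v θ) μ (h : L) =
    WeylAlgebra.euler (fun α : PosRoot b => if α = θ then 0 else α.form h) +
      algebraMap ℂ _ (μ h) := by
  rw [B.v_eq, B.diffOp_uSum_coe]
  simp [ite_not]

theorem diffOp_u_coe_eq (h : H) : B.diffOp B.u μ (h : L) = B.diffOp (B.v θ) μ (h : L) +
    θ.form h • (WeylAlgebra.x θ * WeylAlgebra.d θ) := by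
  classical
  rw [diffOp_u_coe, diffOp_v_coe, add_right_comm, WeylAlgebra.euler, WeylAlgebra.euler,
    ← Finset.add_sum_erase _ _ (Finset.mem_univ θ),
    ← Finset.add_sum_erase (a := θ) (f := fun α => (if α = θ then (0 : ℂ) else α.form h) •
      (WeylAlgebra.x α * WeylAlgebra.d α)) _ (Finset.mem_univ θ), if_pos rfl, zero_smul, zero_add,
    add_comm (θ.form h • _)]
  congr 2
  exact Finset.sum_congr rfl fun α hα => by rw [if_neg (Finset.ne_of_mem_erase hα)]

theorem diffOp_v_coe_mul_x (h : H) : B.diffOp (B.v θ) μ (h : L) * WeylAlgebra.x θ =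
    WeylAlgebra.x θ * B.diffOp (B.v θ) μ (h : L) := by
  rw [diffOp_v_coe, add_mul, mul_add, WeylAlgebra.euler_mul_x, if_pos rfl, zero_smul, add_zero,
    Algebra.commutes]

/-- The Euler operator in π(h) gives a coefficient of ∂_α in σ(a) the weight `κ + α(h)` and ∂_α
itself the weight `-α(h)`, so each term has weight `κ`. -/
theorem diffOp_u_coe_mul_diffOp_v {h : H} {a : L} {κ : ℂ} (ha : ⁅(h : L), a⁆ = κ • a) :
    B.diffOp B.u μ (h : L) * B.diffOp (B.v θ) μ a =
      B.diffOp (B.v θ) μ a * B.diffOp B.u μ (h : L) + κ • B.diffOp (B.v θ) μ a := by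
  classical
  obtain ⟨p, q, h', hp, hq⟩ := B.exists_diffOp_eq (S := Finset.univ.erase θ) (h := h)
    (E := WeylAlgebra.eulerDer fun α => α.form h) (κ := κ) (a := a) μ
    (fun α _ => WeylAlgebra.eulerDer_X _ α) ha
  rw [diffOp_u_coe, add_mul, mul_add, Algebra.commutes, add_right_comm, B.v_eq θ, h']
  congr 1
  refine mul_neg_sum_add_eq (r := fun α => α.form h) (fun i => ?_) (fun i => ?_) ?_
  · rw [WeylAlgebra.euler_mul_ofPoly, hp, map_smul]
  · rw [WeylAlgebra.euler_mul_d]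
  · rw [WeylAlgebra.euler_mul_ofPoly, hq, map_smul]

open scoped Classical in
theorem op_diffOp_v_coe (h : H) (c : PosRoot b → ℕ) :
    WeylAlgebra.op θ (B.diffOp (B.v θ) μ (h : L)) (WeylAlgebra.gtVector θ c) =
      (-(∑ α ∈ Finset.univ.erase θ, α.form h * (c α + 1)) + μ h) • WeylAlgebra.gtVector θ c := by
  rw [diffOp_v_coe, WeylAlgebra.op_add_algebraMap (WeylAlgebra.op_euler _ _ _), if_pos rfl, zero_mul,
    add_zero]
  congr 3
  refine Finset.sum_congr (by congr!) fun α hα => ?_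
  rw [if_neg (Finset.ne_of_mem_erase hα)]

open scoped Classical in
theorem op_diffOp_u_coe (h : H) (c : PosRoot b → ℕ) :
    WeylAlgebra.op θ (B.diffOp B.u μ (h : L)) (WeylAlgebra.gtVector θ c) =
      (-(∑ α ∈ Finset.univ.erase θ, α.form h * (c α + 1)) + θ.form h * c θ + μ h) •
        WeylAlgebra.gtVector θ c := by
  rw [diffOp_u_coe, WeylAlgebra.op_add_algebraMap (WeylAlgebra.op_euler _ _ _)]
  congr!

theorem op_casS {lam : Module.Dual ℂ H} {c : PosRoot b → ℕ} {m : ℂ}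
    (h : WeylAlgebra.op θ (B.sigmaMap θ lam (θ.coroot : L)) (WeylAlgebra.gtVector θ c) =
      m • WeylAlgebra.gtVector θ c) :
    WeylAlgebra.op θ (B.casS θ lam) (WeylAlgebra.gtVector θ c) =
      ((1 / 2 : ℂ) * m * (m - 2)) • WeylAlgebra.gtVector θ c := by
  have h₂ : WeylAlgebra.op θ (2 : WeylAlgebra (PosRoot b)) (WeylAlgebra.gtVector θ c) =
      (2 : ℂ) • WeylAlgebra.gtVector θ c := by
    rw [map_ofNat, Module.End.ofNat_apply]
    exact (two_nsmul _).trans (two_smul (M := WeylAlgebra.GTModule θ) ℂ _).symm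
  rw [casS, map_smul, map_mul, map_sub, LinearMap.smul_apply, Module.End.mul_apply,
    LinearMap.sub_apply, h, h₂, map_sub, map_smul, map_smul, h]
  module

theorem isSemisimple_op_casS (lam : Module.Dual ℂ H) :
    (WeylAlgebra.op θ (B.casS θ lam)).IsSemisimple :=
  Module.End.isSemisimple_of_span_eigenvectors _ _ WeylAlgebra.span_gtVector _
    fun c => B.op_casS θ (B.op_diffOp_v_coe θ _ _ c)

section Maximal

variable {θ} (hθ : IsMaximalRoot θ)

include hθ

theorem diffOp_u_f : B.diffOp B.u μ (B.f θ) = -WeylAlgebra.d θ :=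
  B.diffOp_f μ (B.isNilpotent_adPoly_uSum _) (B.adPoly_uSum_f hθ _ 1)

theorem diffOp_v_f : B.diffOp (B.v θ) μ (B.f θ) = -WeylAlgebra.d θ :=
  B.diffOp_f μ (B.isNilpotent_adPoly_uSum _) (B.adPoly_uSum_f hθ _ 1)

theorem isLocallyNilpotent_op_casN (lam : Module.Dual ℂ H) :
    IsLocallyNilpotent (WeylAlgebra.op θ (B.casN θ lam)) := by
  have hc : Commute ((-2 : ℂ) • B.sigmaMap θ lam (B.e θ)) (WeylAlgebra.d θ) :=
    Commute.smul_left (B.d_mul_diffOp_v θ _ _).symm _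
  have h : B.casN θ lam = ((-2 : ℂ) • B.sigmaMap θ lam (B.e θ)) * WeylAlgebra.d θ := by
    rw [casN, sigmaMap, sigmaMap, B.diffOp_v_f _ hθ, WeylAlgebra.mul_neg_eq, two_mul,
      smul_mul_assoc]
    module
  rw [h]
  exact WeylAlgebra.isLocallyNilpotent_op hc

variable (T : IsSl2Triple (θ.coroot : L) (B.e θ) (B.f θ)) (lam : Module.Dual ℂ H)

theorem exists_algHom_piMap :
    ∃ Φ : UniversalEnvelopingAlgebra ℂ (T.toLieSubalgebra ℂ) →ₐ[ℂ] WeylAlgebra (PosRoot b),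
      (∀ y : T.toLieSubalgebra ℂ,
        Φ (UniversalEnvelopingAlgebra.ι ℂ y) = B.piMap lam (y : L)) ∧
      Φ (casimirElement T) = B.casS θ lam + B.casN θ lam := by
  set μ := lam + weylVector b with hμ
  have hh := B.diffOp_u_coe_eq θ μ θ.coroot
  rw [θ.form_coroot] at hh
  have he := B.diffOp_u_e hθ μ T
  have hf := B.diffOp_u_f μ hθ
  have hdx := WeylAlgebra.d_mul_x_self θ
  have hsx := B.diffOp_v_coe_mul_x θ μ θ.coroot
  have hsd := (B.d_mul_diffOp_v θ μ (θ.coroot : L)).symm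
  have hde := B.d_mul_diffOp_v θ μ (B.e θ)
  have hhe := B.diffOp_u_coe_mul_diffOp_v θ μ (T.lie_h_e_smul ℂ)
  rw [hh] at hhe
  obtain ⟨Φ, hΦ, hC⟩ := T.exists_algHom (B.diffOpLin B.u μ)
    (by
      change B.diffOp _ _ _ * B.diffOp _ _ _ - B.diffOp _ _ _ * B.diffOp _ _ _ =
        (2 : ℂ) • B.diffOp _ _ _
      rw [hh, he]
      exact sl2_lie_h_e hsx hsd hdx hhe)
    (by
      change B.diffOp _ _ _ * B.diffOp _ _ _ - B.diffOp _ _ _ * B.diffOp _ _ _ =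
        -((2 : ℂ) • B.diffOp _ _ _)
      rw [hh, hf]
      exact sl2_lie_h_f hsd hdx)
    (by
      change B.diffOp _ _ _ * B.diffOp _ _ _ - B.diffOp _ _ _ * B.diffOp _ _ _ = B.diffOp _ _ _
      rw [hh, he, hf]
      exact sl2_lie_e_f hsd hdx hde)
  refine ⟨Φ, hΦ, hC.trans ?_⟩
  change B.diffOp _ _ _ * B.diffOp _ _ _ + B.diffOp _ _ _ * B.diffOp _ _ _ +
    (1 / 2 : ℂ) • B.diffOp _ _ _ ^ 2 = _
  rw [hh, he, hf, casS, casN, sigmaMap, sigmaMap, sigmaMap, ← hμ, B.diffOp_v_f _ hθ]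
  exact sl2_casimir hsx hsd hdx hde

end Maximal

open scoped Classical in
-- The shifts `c α + 1` are absorbed by `2ρ = θ + ∑_{α ≠ θ} α`. One `ρ` comes from the definition of
-- π, the other from the parameter `λ + ρ`.
theorem gtWeight_natCast (c : PosRoot b → ℕ) (h : H) :
    gtWeight θ μ (fun α => (c α : ℤ)) h =
      -(∑ α ∈ Finset.univ.erase θ, α.form h * (c α + 1)) + θ.form h * c θ +
        (μ + weylVector b + weylVector b) h := by
  have hρ : weylVector b + weylVector b = θ.form + ∑ α ∈ Finset.univ.erase θ, α.form := by
    rw [Finset.add_sum_erase _ _ (Finset.mem_univ θ), weylVector, ← add_smul]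
    norm_num
  rw [gtWeight, add_assoc μ, hρ]
  simp only [LinearMap.add_apply, LinearMap.neg_apply, LinearMap.sum_apply, LinearMap.smul_apply,
    mul_add, mul_one, Finset.sum_add_distrib, zsmul_eq_mul, Int.cast_natCast, mul_comm (_ : ℂ) (c _ : ℂ)]
  ring

end RootBasis

end Roots

end

/-! ### The main theorem -/

theorem mainTheorem4 {L : Type*} [LieRing L] [LieAlgebra ℂ L] [FiniteDimensional ℂ L]
    [LieAlgebra.IsSimple ℂ L] (H : LieSubalgebra ℂ L) [H.IsCartanSubalgebra]
    (hrank : 2 ≤ Module.finrank ℂ H)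
    (b : (rootSystem H).Base) (B : RootBasis b)
    (θ : PosRoot b) (hθ : IsMaximalRoot θ)
    (T : IsSl2Triple (θ.coroot : L) (B.e θ) (B.f θ))
    (lam : Module.Dual ℂ H) :
    -- the image of the Casimir element and its two parts
    (∃ Φ : UniversalEnvelopingAlgebra ℂ (T.toLieSubalgebra ℂ) →ₐ[ℂ] WeylAlgebra (PosRoot b),
      (∀ y : T.toLieSubalgebra ℂ,
        Φ (UniversalEnvelopingAlgebra.ι ℂ y) = B.piMap lam (y : L)) ∧
      Φ (casimirElement T) = B.casS θ lam + B.casN θ lam) ∧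
    (WeylAlgebra.op θ (B.casS θ lam)).IsSemisimple ∧
    IsLocallyNilpotent (WeylAlgebra.op θ (B.casN θ lam)) ∧
    -- the eigenvectors of the semisimple part
    ∀ a : b.support → ℤ, ∃ na : ℕ,
      IsLeast {n : ℕ | 0 ≤ extendZero a + n • tVec θ θ} na ∧
      ∀ (nθ : ℕ), ∀ t ∈ lambdaPlusTheta θ, ∀ c : PosRoot b → ℕ,
        (∀ β, (c β : ℤ) = (extendZero a + (na + nθ) • tVec θ θ + t) β) →
        (∀ h : H, WeylAlgebra.op θ (B.piMap (lam + weylVector b) (h : L))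
            (WeylAlgebra.gtVector θ c) =
          gtWeight θ lam (extendZero a) h • WeylAlgebra.gtVector θ c) ∧
        (WeylAlgebra.op θ (B.casS θ (lam + weylVector b))).HasEigenvector
          ((1 / 2 : ℂ) * (gtWeight θ lam (extendZero a) θ.coroot - 2 * ((na : ℂ) + nθ)) *
            (gtWeight θ lam (extendZero a) θ.coroot - 2 * ((na : ℂ) + nθ + 1)))
          (WeylAlgebra.gtVector θ c) := by
  classical
  refine ⟨B.exists_algHom_piMap hθ T lam, B.isSemisimple_op_casS θ lam,
    B.isLocallyNilpotent_op_casN hθ lam, fun a => ?_⟩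
  obtain ⟨na, hna⟩ := hθ.exists_isLeast a
  refine ⟨na, hna, fun nθ t ht c hc => ?_⟩
  have hθ' := hθ.notMem_support hrank
  have hc' : (fun β => (c β : ℤ)) = extendZero a + (na + nθ) • tVec θ θ + t := funext hc
  have hw : gtWeight θ lam (fun β => (c β : ℤ)) = gtWeight θ lam (extendZero a) := by
    rw [hc', gtWeight_eq, gtWeight_eq, map_add, map_add, map_nsmul, gtLinear_tVec hθ' hθ',
      gtLinear_eq_zero_of_mem hθ' ht, smul_zero, add_zero, add_zero]
  -- At the non-simple root `θ` both `a` and `t` vanish and `t_θ` equals 1.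
  have hcθ : (c θ : ℂ) = (na : ℂ) + nθ := by
    have h := hc θ
    rw [Pi.add_apply, Pi.add_apply, Pi.smul_apply, apply_self_eq_zero_of_mem hθ' ht,
      tVec_self_apply_self hθ', extendZero, dif_neg hθ'] at h
    have h' : (c θ : ℤ) = ((na + nθ : ℕ) : ℤ) := by simpa using h
    exact_mod_cast h'
  refine ⟨fun h => ?_, Module.End.mem_eigenspace_iff.2 ?_, WeylAlgebra.gtVector_ne_zero c⟩
  · rw [← hw, RootBasis.gtWeight_natCast]
    exact B.op_diffOp_u_coe θ _ h c
  -- The eigenvalue of σ(h_θ) is that of π(h_θ) minus `θ(h_θ) c_θ = 2 (n_a + n_θ)`.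
  · have hm := RootBasis.gtWeight_natCast θ lam c θ.coroot
    rw [hw, θ.form_coroot, hcθ] at hm
    refine (B.op_casS θ (B.op_diffOp_v_coe θ _ _ c)).trans ?_
    congr 1
    rw [hm]
    ring
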